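/- Let $(M_p)_{p\in\mathbb N_0}$ be a sequence of positive numbers, monotonically increasing to infinity, with $M_0=1$ and - $(M.1)$ $M_p^2\le M_{p-1}M_{p+1}$ for $p\ge 1$; - $(M.2)$ there are $A,H>0$ with $M_{p+q}\le A H^{p+q}M_pM_q$ for all $p,q\in\mathbb N_0$; - $(M.3)'$ $\sum_{p\ge1}M_{p-1}/M_p<\infty$. Let $M(\rho)=\sup_{p}\ln_+(\rho^pM_0/M_p)$ for $\rho>0$, $M(0)=0$, be its associated function. Call $M$ *doubling* if there are constants $L,C$ with $M(2\rho)\le L\,M(\rho)+C$ for all $\rho>0$ (this holds, for example, for $M_p=p!^s$, $s>1$). Let $\mathcal E^{(M_p)}(\mathbb R^d)$ be the space of all $\varphi\in C^\infty(\mathbb R^d)$ with $\|\varphi\|_{M_p,A,K}=\sup_{\alpha}\sup_{x\in K}\frac{A^{|\alpha|}}{M_{|\alpha|}}|\partial^\alpha\varphi(x)|<\infty$ for all compact $K$ and all $A>0$, with the topology given by these seminorms. Let $\mathcal D^{(M_p)}(\mathbb R^d)$ be its subspace of compactly supported functions, with the inductive limit topology of the spaces $\mathcal D^{(M_p)}_K=\{\varphi:\operatorname{supp}\varphi\subseteq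 K\}$. Let $\mathcal S^{(M_p)}(\mathbb R^d)$ be the space of all $\varphi\in C^\infty(\mathbb R^d)$ such that for all $A,B>0$ there is $C>0$ with $|x^\alpha\partial^\beta\varphi(x)|\le C A^{|\alpha|}M_{|\alpha|}B^{|\beta|}M_{|\beta|}$ for all $\alpha,\beta,x$. Primes denote the spaces of continuous linear functionals. An $f\in(\mathcal D^{(M_p)})'$ is said to belong to $(\mathcal E^{(M_p)})'$ (to be a compactly supported ultradistribution) if it is the restriction to $\mathcal D^{(M_p)}$ of an element of $(\mathcal E^{(M_p)})'$. The short-time Fourier transform of $f$ with window $\phi$ is $$V_\phi f(x,\xi)=(2\pi)^{-d/2}\,\big\langle f(y),\ \overline{\phi(y-x)}\,e^{-i\langle\xi,y\rangle}\big\rangle ,\qquad x,\xi\in\mathbb R^d,$$ with $f$ acting linearly in the variable $y$. **Proposition.** 1. Let $f\in(\mathcal E^{(M_p)})'(\mathbb R^d)$ and $\phi\in\mathcal S^{(M_p)}(\mathbb R^d)$. Then there is $\varepsilon>0$ such that for every $h>0$ there is $C>0$ with $$|V_\phi f(x,\xi)|\le C e^{-hM(|x|)}e^{M(\varepsilon|\xi|)}\qquad\text{for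 all }x,\xi\in\mathbb R^d .$$ If $M$ is doubling, then there is also $\varepsilon>0$ such that for every $h>0$ there is $C>0$ with $$|V_\phi f(x,\xi)|\le C e^{-hM(|x|)}e^{\varepsilon M(|\xi|)}\qquad\text{for all }x,\xi\in\mathbb R^d .$$ 2. Let $f\in(\mathcal D^{(M_p)})'(\mathbb R^d)$ and $\phi\in\mathcal D^{(M_p)}(\mathbb R^d)\setminus\{0\}$. Then $f$ belongs to $(\mathcal E^{(M_p)})'(\mathbb R^d)$ if and only if there is a compact set $K\subset\mathbb R^d$ with $\operatorname{supp}V_\phi f\subseteq K\times\mathbb R^d$. In that case there are $\varepsilon,C>0$ with $$|V_\phi f(x,\xi)|\le C e^{M(\varepsilon|\xi|)}\qquad\text{for all }x,\xi\in\mathbb R^d ,$$ and, if $M$ is doubling, there are $\varepsilon,C>0$ with $$|V_\phi f(x,\xi)|\le C e^{\varepsilon M(|\xi|)}\qquad\text{for all }x,\xi\in\mathbb R^d .$$ -/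

import Mathlib

open Set Filter Topology
open scoped ContDiff

noncomputable section

/-- `ℝ^d` with its Euclidean norm. -/
abbrev RSpace (d : ℕ) : Type := EuclideanSpace ℝ (Fin d)

/-- The standing assumptions on the defining sequence `(M_p)`: positive, `M_0 = 1`, monotonically
increasing to infinity, and the conditions (M.1) (logarithmic convexity), (M.2) (stability under
ultradifferential operators) and (M.3)' (non-quasianalyticity). -/
structure IsDefiningSequence (M : ℕ → ℝ) : Prop where
  pos : ∀ p, 0 < M p
  zero : M 0 = 1
  mono : Monotone M
  tendsto : Tendsto M atTop atTop
  m1 : ∀ p, 1 ≤ p → M p ^ 2 ≤ M (p - 1) * M (p + 1)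
  m2 : ∃ A > 0, ∃ H > 0, ∀ p q, M (p + q) ≤ A * H ^ (p + q) * M p * M q
  m3 : Summable fun p : ℕ => M p / M (p + 1)

/-- The associated function `M(ρ) = sup_p ln₊ (ρ^p M_0 / M_p)`, where `ln₊ t = max (ln t) 0`
(and `ln₊ 0 = 0`, so that `M(0) = 0`). -/
def assocFun (M : ℕ → ℝ) (ρ : ℝ) : ℝ := ⨆ p : ℕ, Real.posLog (ρ ^ p * M 0 / M p)

/-- The doubling property of the associated function: `M(2ρ) ≤ L M(ρ) + C` for all `ρ > 0`. -/
def AssocDoubling (M : ℕ → ℝ) : Prop :=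
  ∃ L C : ℝ, ∀ ρ : ℝ, 0 < ρ → assocFun M (2 * ρ) ≤ L * assocFun M ρ + C

/-- The mixed partial derivative `∂_{i 0} ∂_{i 1} ⋯ ∂_{i (n-1)} φ (x)` of order `n`. When `i` ranges
over all maps `Fin n → Fin d`, these are exactly the derivatives `∂^α φ (x)` over all
multi-indices `α` with `|α| = n`. -/
def mixedPartial {d n : ℕ} (i : Fin n → Fin d) (φ : RSpace d → ℂ) (x : RSpace d) : ℂ :=
  iteratedFDeriv ℝ n φ x fun k => EuclideanSpace.single (i k) (1 : ℝ)

theorem mixedPartial_add {d n : ℕ} (i : Fin n → Fin d) {φ ψ : RSpace d → ℂ}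
    (hφ : ContDiff ℝ ∞ φ) (hψ : ContDiff ℝ ∞ ψ) (x : RSpace d) :
    mixedPartial i (φ + ψ) x = mixedPartial i φ x + mixedPartial i ψ x := by
  unfold mixedPartial
  rw [iteratedFDeriv_add_apply ((hφ.of_le (by exact_mod_cast le_top)).contDiffAt)
    ((hψ.of_le (by exact_mod_cast le_top)).contDiffAt)]
  rfl

theorem mixedPartial_smul {d n : ℕ} (i : Fin n → Fin d) (c : ℂ) {φ : RSpace d → ℂ}
    (hφ : ContDiff ℝ ∞ φ) (x : RSpace d) :
    mixedPartial i (c • φ) x = c * mixedPartial i φ x := by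
  unfold mixedPartial
  rw [iteratedFDeriv_const_smul_apply ((hφ.of_le (by exact_mod_cast le_top)).contDiffAt)]
  rfl

theorem mixedPartial_zero {d n : ℕ} (i : Fin n → Fin d) (x : RSpace d) :
    mixedPartial i (0 : RSpace d → ℂ) x = 0 := by
  have := mixedPartial_smul i (0 : ℂ) (φ := (0 : RSpace d → ℂ)) contDiff_const x
  simpa using this

/-- The set of numbers `A^{|α|} / M_{|α|} * |∂^α φ (x)|`, over all multi-indices `α` and `x ∈ K`. -/
def ultraValues (M : ℕ → ℝ) {d : ℕ} (A : ℝ) (K : Set (RSpace d)) (φ : RSpace d → ℂ) : Set ℝ :=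
  {r | ∃ (n : ℕ) (i : Fin n → Fin d) (x : RSpace d),
    x ∈ K ∧ r = A ^ n / M n * ‖mixedPartial i φ x‖}

/-- The norm `‖φ‖_{M_p, A, K} = sup_α sup_{x ∈ K} A^{|α|} / M_{|α|} * |∂^α φ (x)|`; it is only used
for functions for which the supremum is finite. -/
def ultraNorm (M : ℕ → ℝ) {d : ℕ} (A : ℝ) (K : Set (RSpace d)) (φ : RSpace d → ℂ) : ℝ :=
  sSup (ultraValues M A K φ)

theorem bddAbove_ultraValues {M : ℕ → ℝ} {d : ℕ} {A : ℝ} {K : Set (RSpace d)} {φ : RSpace d → ℂ} :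
    BddAbove (ultraValues M A K φ) ↔
      ∃ C, ∀ (n : ℕ) (i : Fin n → Fin d), ∀ x ∈ K, A ^ n / M n * ‖mixedPartial i φ x‖ ≤ C := by
  constructor
  · rintro ⟨C, hC⟩
    exact ⟨C, fun n i x hx => hC ⟨n, i, x, hx, rfl⟩⟩
  · rintro ⟨C, hC⟩
    refine ⟨C, ?_⟩
    rintro r ⟨n, i, x, hx, rfl⟩
    exact hC n i x hx

/-- The space `𝓔^{(M_p)}(ℝ^d)` of ultradifferentiable functions of Beurling type: smooth functions
for which `‖φ‖_{M_p, A, K} < ∞` for every compact `K` and every `A > 0`. -/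
def BeurlingE {M : ℕ → ℝ} (hM : IsDefiningSequence M) (d : ℕ) : Submodule ℂ (RSpace d → ℂ) where
  carrier := {φ | ContDiff ℝ ∞ φ ∧
    ∀ K : Set (RSpace d), IsCompact K → ∀ A : ℝ, 0 < A → BddAbove (ultraValues M A K φ)}
  zero_mem' := by
    refine ⟨contDiff_const, fun K _ A _ => bddAbove_ultraValues.2 ⟨0, fun n i x _ => ?_⟩⟩
    rw [mixedPartial_zero]; simp
  add_mem' := by
    rintro φ ψ ⟨hφ, hφ'⟩ ⟨hψ, hψ'⟩
    refine ⟨hφ.add hψ, fun K hK A hA => ?_⟩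
    obtain ⟨C, hC⟩ := bddAbove_ultraValues.1 (hφ' K hK A hA)
    obtain ⟨D, hD⟩ := bddAbove_ultraValues.1 (hψ' K hK A hA)
    refine bddAbove_ultraValues.2 ⟨C + D, fun n i x hx => ?_⟩
    rw [mixedPartial_add i hφ hψ]
    have h0 : 0 ≤ A ^ n / M n := div_nonneg (pow_nonneg hA.le n) (hM.pos n).le
    have := mul_le_mul_of_nonneg_left (norm_add_le (mixedPartial i φ x) (mixedPartial i ψ x)) h0
    have h1 := hC n i x hx
    have h2 := hD n i x hx
    linarith [mul_add (A ^ n / M n) ‖mixedPartial i φ x‖ ‖mixedPartial i ψ x‖]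
  smul_mem' := by
    rintro c φ ⟨hφ, hφ'⟩
    refine ⟨contDiff_const.smul hφ, fun K hK A hA => ?_⟩
    obtain ⟨C, hC⟩ := bddAbove_ultraValues.1 (hφ' K hK A hA)
    refine bddAbove_ultraValues.2 ⟨‖c‖ * C, fun n i x hx => ?_⟩
    rw [mixedPartial_smul i c hφ, norm_mul, mul_left_comm]
    exact mul_le_mul_of_nonneg_left (hC n i x hx) (norm_nonneg c)

/-- The space `𝓓^{(M_p)}(ℝ^d)`: the compactly supported elements of `𝓔^{(M_p)}(ℝ^d)`. -/
def BeurlingD {M : ℕ → ℝ} (hM : IsDefiningSequence M) (d : ℕ) : Submodule ℂ (RSpace d → ℂ) where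
  carrier := {φ | φ ∈ BeurlingE hM d ∧ HasCompactSupport φ}
  zero_mem' := ⟨(BeurlingE hM d).zero_mem, HasCompactSupport.zero⟩
  add_mem' := fun hφ hψ => ⟨(BeurlingE hM d).add_mem hφ.1 hψ.1, hφ.2.add hψ.2⟩
  smul_mem' := fun c _ hφ => ⟨(BeurlingE hM d).smul_mem c hφ.1, hφ.2.smul_left (f := fun _ => c)⟩

theorem BeurlingD_le_BeurlingE {M : ℕ → ℝ} (hM : IsDefiningSequence M) (d : ℕ) :
    BeurlingD hM d ≤ BeurlingE hM d := fun _ h => h.1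

/-- The Gelfand-Shilov space `𝓢^{(M_p)}(ℝ^d) = Σ^{M_p}_{M_p}(ℝ^d)`: smooth functions such that for
all `A, B > 0` there is `C > 0` with
`|x^α ∂^β φ (x)| ≤ C A^{|α|} M_{|α|} B^{|β|} M_{|β|}` for all `α`, `β`, `x`. -/
def BeurlingS (M : ℕ → ℝ) (d : ℕ) : Set (RSpace d → ℂ) :=
  {φ | ContDiff ℝ ∞ φ ∧ ∀ A : ℝ, 0 < A → ∀ B : ℝ, 0 < B → ∃ C : ℝ, 0 < C ∧
    ∀ (α : Fin d → ℕ) (n : ℕ) (i : Fin n → Fin d) (x : RSpace d),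
      (∏ j, |x j| ^ α j) * ‖mixedPartial i φ x‖ ≤
        C * A ^ (∑ j, α j) * M (∑ j, α j) * B ^ n * M n}

theorem BeurlingS_subset_BeurlingE {M : ℕ → ℝ} (hM : IsDefiningSequence M) {d : ℕ}
    {φ : RSpace d → ℂ} (hφ : φ ∈ BeurlingS M d) : φ ∈ BeurlingE hM d := by
  refine ⟨hφ.1, fun K _ A hA => ?_⟩
  obtain ⟨C, hC, h⟩ := hφ.2 1 one_pos A⁻¹ (inv_pos.2 hA)
  refine bddAbove_ultraValues.2 ⟨C, fun n i x _ => ?_⟩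
  have h1 := h (fun _ => 0) n i x
  simp only [pow_zero, Finset.prod_const_one, one_mul, Finset.sum_const_zero, hM.zero,
    mul_one] at h1
  have hMn := hM.pos n
  have hAn : 0 < A ^ n := pow_pos hA n
  calc A ^ n / M n * ‖mixedPartial i φ x‖ ≤ A ^ n / M n * (C * A⁻¹ ^ n * M n) :=
        mul_le_mul_of_nonneg_left h1 (div_pos hAn hMn).le
    _ = C := by rw [inv_pow]; field_simp

/-- The dual `(𝓔^{(M_p)})'(ℝ^d)` of the Fréchet space `𝓔^{(M_p)}(ℝ^d)`: a linear functional is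
continuous iff it is bounded by a multiple of one of the (directed) defining seminorms. -/
def BeurlingEDual {M : ℕ → ℝ} (hM : IsDefiningSequence M) (d : ℕ) :
    Set (BeurlingE hM d →ₗ[ℂ] ℂ) :=
  {f | ∃ K : Set (RSpace d), IsCompact K ∧ ∃ A : ℝ, 0 < A ∧ ∃ C : ℝ,
    ∀ φ : BeurlingE hM d, ‖f φ‖ ≤ C * ultraNorm M A K (φ : RSpace d → ℂ)}

/-- The dual `(𝓓^{(M_p)})'(ℝ^d)` of the inductive limit `𝓓^{(M_p)}(ℝ^d)` of the Fréchet spaces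
`𝓓^{(M_p)}_K`: a linear functional is continuous iff its restriction to every `𝓓^{(M_p)}_K`,
`K` compact, is bounded by a multiple of one of the norms `‖·‖_{M_p, A, K}`. -/
def BeurlingDDual {M : ℕ → ℝ} (hM : IsDefiningSequence M) (d : ℕ) :
    Set (BeurlingD hM d →ₗ[ℂ] ℂ) :=
  {f | ∀ K : Set (RSpace d), IsCompact K → ∃ A : ℝ, 0 < A ∧ ∃ C : ℝ,
    ∀ φ : BeurlingD hM d, tsupport (φ : RSpace d → ℂ) ⊆ K →
      ‖f φ‖ ≤ C * ultraNorm M A K (φ : RSpace d → ℂ)}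

/-- An ultradistribution `f` on `𝓓^{(M_p)}` belongs to `(𝓔^{(M_p)})'`, i.e. it is the restriction of a
continuous linear functional on `𝓔^{(M_p)}`. -/
def BelongsToEDual {M : ℕ → ℝ} (hM : IsDefiningSequence M) {d : ℕ}
    (f : BeurlingD hM d →ₗ[ℂ] ℂ) : Prop :=
  ∃ g ∈ BeurlingEDual hM d, ∀ φ : BeurlingD hM d,
    f φ = g ⟨φ, BeurlingD_le_BeurlingE hM d φ.2⟩

/-- The function `y ↦ conj (φ (y - x)) e^{-i ⟨ξ, y⟩}`. -/
def stftAtom {d : ℕ} (φ : RSpace d → ℂ) (x ξ : RSpace d) (y : RSpace d) : ℂ :=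
  (starRingEnd ℂ) (φ (y - x)) * Complex.exp (-Complex.I * ((inner ℝ ξ y : ℝ) : ℂ))

theorem IsDefiningSequence.mul_le {M : ℕ → ℝ} (hM : IsDefiningSequence M) (p q : ℕ) :
    M p * M q ≤ M (p + q) := by
  have ratio : ∀ q p, M (q + 1) * M (q + p) ≤ M q * M (q + p + 1) := by
    intro q p
    induction p with
    | zero => simp [mul_comm]
    | succ p ih =>
      have h := hM.m1 (q + p + 1) (by omega)
      simp only [Nat.add_sub_cancel] at h
      have ha := hM.pos (q + p)
      have hb := hM.pos (q + p + 1)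
      have hc := hM.pos (q + p + 1 + 1)
      have hd := hM.pos q
      have he := hM.pos (q + 1)
      rw [show q + (p + 1) = q + p + 1 by ring]
      have : M (q + p) * (M (q + 1) * M (q + p + 1)) ≤ M (q + p) * (M q * M (q + p + 1 + 1)) := by
        nlinarith [mul_le_mul_of_nonneg_right ih hb.le, mul_le_mul_of_nonneg_left h hd.le]
      exact le_of_mul_le_mul_left this ha
  induction q with
  | zero => simp [hM.zero]
  | succ q ih =>
    have hq := hM.pos q
    have hq' := hM.pos (q + 1)
    have h := ratio q p
    rw [show q + p = p + q by ring] at h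
    have : M q * (M p * M (q + 1)) ≤ M q * M (p + q + 1) := by
      nlinarith [mul_le_mul_of_nonneg_right ih hq'.le]
    exact le_of_mul_le_mul_left this hq

theorem IsDefiningSequence.exists_pow_le {M : ℕ → ℝ} (hM : IsDefiningSequence M) {r : ℝ}
    (hr : 0 ≤ r) : ∃ C, 0 < C ∧ ∀ k, r ^ k ≤ C * M k := by
  have hs : Summable fun k : ℕ => (r + 1) ^ k / M k := by
    refine summable_of_ratio_test_tendsto_lt_one (l := 0) one_pos
      (Eventually.of_forall fun k => (div_pos (by positivity) (hM.pos k)).ne') ?_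
    have h := (hM.m3.tendsto_atTop_zero).const_mul (r + 1)
    rw [mul_zero] at h
    refine h.congr fun k => ?_
    have h1 := hM.pos k
    have h2 := hM.pos (k + 1)
    rw [Real.norm_of_nonneg (by positivity), Real.norm_of_nonneg (by positivity)]
    field_simp
    ring
  have hn : ∀ k, 0 ≤ (r + 1) ^ k / M k := fun k => div_nonneg (by positivity) (hM.pos k).le
  refine ⟨∑' k : ℕ, (r + 1) ^ k / M k + 1, add_pos_of_nonneg_of_pos (tsum_nonneg hn) one_pos,
    fun k => ?_⟩
  have h1 : (r + 1) ^ k / M k ≤ ∑' k : ℕ, (r + 1) ^ k / M k :=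
    hs.le_tsum k fun j _ => hn j
  have h2 : r ^ k ≤ (r + 1) ^ k := by gcongr; linarith
  rw [div_le_iff₀ (hM.pos k)] at h1
  nlinarith [hM.pos k]

theorem norm_mixedPartial_le {d n : ℕ} (i : Fin n → Fin d) (φ : RSpace d → ℂ) (x : RSpace d) :
    ‖mixedPartial i φ x‖ ≤ ‖iteratedFDeriv ℝ n φ x‖ := by
  refine (ContinuousMultilinearMap.le_opNorm _ _).trans ?_
  simp

theorem norm_iteratedFDeriv_le_of_mixedPartial {d n : ℕ} {φ : RSpace d → ℂ} {x : RSpace d} {B : ℝ}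
    (hB : 0 ≤ B) (h : ∀ i : Fin n → Fin d, ‖mixedPartial i φ x‖ ≤ B) :
    ‖iteratedFDeriv ℝ n φ x‖ ≤ (d : ℝ) ^ n * B := by
  refine ContinuousMultilinearMap.opNorm_le_bound (by positivity) fun v => ?_
  have hv : v = fun k => ∑ j : Fin d, v k j • EuclideanSpace.single j (1 : ℝ) := by
    funext k
    ext l
    simp [Finset.sum_apply, Pi.single_apply]
  have hsum : iteratedFDeriv ℝ n φ x v =
      ∑ i : Fin n → Fin d, (∏ k, v k (i k)) • mixedPartial i φ x := by
    conv_lhs => rw [hv]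
    rw [ContinuousMultilinearMap.map_sum]
    refine Finset.sum_congr rfl fun i _ => ?_
    rw [ContinuousMultilinearMap.map_smul_univ]
    rfl
  rw [hsum]
  calc ‖∑ i : Fin n → Fin d, (∏ k, v k (i k)) • mixedPartial i φ x‖
      ≤ ∑ _i : Fin n → Fin d, B * ∏ k, ‖v k‖ := by
        refine norm_sum_le_of_le _ fun i _ => ?_
        rw [norm_smul, norm_prod, mul_comm B]
        have : ∏ k, ‖v k (i k)‖ ≤ ∏ k, ‖v k‖ :=
          Finset.prod_le_prod (fun _ _ => norm_nonneg _) fun k _ => PiLp.norm_apply_le (v k) (i k)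
        exact mul_le_mul this (h i) (norm_nonneg _) (Finset.prod_nonneg fun _ _ => norm_nonneg _)
    _ = (d : ℝ) ^ n * B * ∏ k, ‖v k‖ := by
        simp [Finset.sum_const, Finset.card_univ, mul_assoc]

theorem contDiff_stftExp {d : ℕ} (ξ : RSpace d) : ContDiff ℝ ∞
    fun y : RSpace d => Complex.exp (-Complex.I * ((inner ℝ ξ y : ℝ) : ℂ)) := by
  have h1 : ContDiff ℝ ∞ fun y : RSpace d => ((inner ℝ ξ y : ℝ) : ℂ) :=
    Complex.ofRealCLM.contDiff.comp (contDiff_const.inner ℝ contDiff_id)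
  exact (contDiff_const.mul h1).cexp

theorem norm_iteratedFDeriv_stftExp_le {d : ℕ} (ξ : RSpace d) (k : ℕ) (y : RSpace d) :
    ‖iteratedFDeriv ℝ k
      (fun y : RSpace d => Complex.exp (-Complex.I * ((inner ℝ ξ y : ℝ) : ℂ))) y‖ ≤ ‖ξ‖ ^ k := by
  set g : ℝ → ℂ := fun t => Complex.exp (-Complex.I * (t : ℂ)) with hg
  have hgs : ContDiff ℝ ∞ g := (contDiff_const.mul Complex.ofRealCLM.contDiff).cexp
  have hgd : ∀ k : ℕ, iteratedDeriv k g = fun t => (-Complex.I) ^ k * g t := by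
    intro k
    induction k with
    | zero => simp
    | succ k ih =>
      rw [iteratedDeriv_succ, ih]
      funext t
      have h1 : HasDerivAt g (g t * (-Complex.I * 1)) t :=
        ((Complex.ofRealCLM.hasDerivAt (x := t)).const_mul (-Complex.I)).cexp
      rw [(h1.const_mul ((-Complex.I) ^ k)).deriv]
      ring
  have hcomp : (fun y : RSpace d => Complex.exp (-Complex.I * ((inner ℝ ξ y : ℝ) : ℂ))) =
      g ∘ (innerSL ℝ ξ) := by
    funext y
    simp [hg]
  rw [hcomp, ContinuousLinearMap.iteratedFDeriv_comp_right (innerSL ℝ ξ) hgs y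
    (by exact_mod_cast le_top)]
  refine (ContinuousMultilinearMap.norm_compContinuousLinearMap_le _ _).trans ?_
  rw [norm_iteratedFDeriv_eq_norm_iteratedDeriv, hgd]
  have : ‖g (innerSL ℝ ξ y)‖ = 1 := by
    rw [hg]
    simp only [Complex.norm_exp]
    simp
  rw [norm_mul, this]
  simp [innerSL_apply_norm]

/-- The function `y ↦ conj (φ (y - x)) e^{-i ⟨ξ, y⟩}` belongs to `𝓔^{(M_p)}` if `φ` does. -/
theorem stftAtom_mem_BeurlingE {M : ℕ → ℝ} (hM : IsDefiningSequence M) {d : ℕ}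
    {φ : RSpace d → ℂ} (hφ : φ ∈ BeurlingE hM d) (x ξ : RSpace d) :
    stftAtom φ x ξ ∈ BeurlingE hM d := by
  have hφx : ContDiff ℝ ∞ fun y => φ (y - x) := hφ.1.comp (contDiff_id.sub contDiff_const)
  have hc : ContDiff ℝ ∞ fun y => (starRingEnd ℂ) (φ (y - x)) :=
    Complex.conjCLE.contDiff.comp hφx
  have hcn : ∀ (n : ℕ) (y : RSpace d),
      ‖iteratedFDeriv ℝ n (fun y => (starRingEnd ℂ) (φ (y - x))) y‖ =
        ‖iteratedFDeriv ℝ n φ (y - x)‖ := by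
    intro n y
    have h1 := LinearIsometryEquiv.norm_iteratedFDeriv_comp_left (𝕜 := ℝ) Complex.conjLIE
      (fun y => φ (y - x)) y n
    have h2 : (Complex.conjLIE ∘ fun y => φ (y - x)) = fun y => (starRingEnd ℂ) (φ (y - x)) := by
      funext y; simp
    rw [h2] at h1
    rw [h1, iteratedFDeriv_comp_sub]
  refine ⟨hc.mul (contDiff_stftExp ξ), fun K hK A hA => ?_⟩
  have hK' : IsCompact ((fun y => y - x) '' K) := hK.image (by fun_prop)
  obtain ⟨C₀, hC₀⟩ := bddAbove_ultraValues.1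
    (hφ.2 _ hK' (2 * (d + 1) * A) (by positivity))
  set C₁ := max C₀ 0 with hC₁
  have hC₁0 : 0 ≤ C₁ := le_max_right _ _
  obtain ⟨C₂, hC₂0, hC₂⟩ := hM.exists_pow_le (r := 2 * A * ‖ξ‖) (by positivity)
  have hφb : ∀ (j : ℕ), ∀ y ∈ K, A ^ j * ‖iteratedFDeriv ℝ j φ (y - x)‖ ≤ C₁ * M j / 2 ^ j := by
    intro j y hy
    have hMj := hM.pos j
    have h1 : ∀ i : Fin j → Fin d,
        ‖mixedPartial i φ (y - x)‖ ≤ C₁ * M j / (2 * (d + 1) * A) ^ j := by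
      intro i
      have h2 := (hC₀ j i (y - x) ⟨y, hy, rfl⟩).trans (le_max_left C₀ 0)
      rw [le_div_iff₀ (by positivity)]
      rw [div_mul_eq_mul_div, div_le_iff₀ hMj] at h2
      linarith
    have h3 := norm_iteratedFDeriv_le_of_mixedPartial (by positivity) h1
    calc A ^ j * ‖iteratedFDeriv ℝ j φ (y - x)‖
        ≤ A ^ j * ((d : ℝ) ^ j * (C₁ * M j / (2 * (d + 1) * A) ^ j)) := by gcongr
      _ ≤ A ^ j * (((d : ℝ) + 1) ^ j * (C₁ * M j / (2 * (d + 1) * A) ^ j)) := by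
          gcongr; linarith
      _ = C₁ * M j / 2 ^ j := by
          rw [mul_pow, mul_pow]; field_simp
  refine bddAbove_ultraValues.2 ⟨C₁ * C₂, fun n i y hy => ?_⟩
  have hMn := hM.pos n
  rw [div_mul_eq_mul_div, div_le_iff₀ hMn]
  have hprod := norm_iteratedFDeriv_mul_le (𝕜 := ℝ) hc (contDiff_stftExp ξ) y (n := n)
    (by exact_mod_cast le_top)
  calc A ^ n * ‖mixedPartial i (stftAtom φ x ξ) y‖
      ≤ A ^ n * ‖iteratedFDeriv ℝ n (stftAtom φ x ξ) y‖ := by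
        gcongr; exact norm_mixedPartial_le i _ y
    _ ≤ A ^ n * ∑ j ∈ Finset.range (n + 1), (n.choose j : ℝ) *
          ‖iteratedFDeriv ℝ j (fun y => (starRingEnd ℂ) (φ (y - x))) y‖ *
          ‖iteratedFDeriv ℝ (n - j)
            (fun y : RSpace d => Complex.exp (-Complex.I * ((inner ℝ ξ y : ℝ) : ℂ))) y‖ := by
        gcongr; exact hprod
    _ ≤ ∑ j ∈ Finset.range (n + 1), (n.choose j : ℝ) * (C₁ * C₂ * M n / 2 ^ n) := by
        rw [Finset.mul_sum]
        refine Finset.sum_le_sum fun j hj => ?_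
        have hjn : j ≤ n := by simpa [Nat.lt_succ_iff] using hj
        rw [hcn]
        have e1 := hφb j y hy
        have e2 : A ^ (n - j) * ‖iteratedFDeriv ℝ (n - j)
            (fun y : RSpace d => Complex.exp (-Complex.I * ((inner ℝ ξ y : ℝ) : ℂ))) y‖ ≤
            C₂ * M (n - j) / 2 ^ (n - j) := by
          rw [le_div_iff₀ (by positivity)]
          refine le_trans ?_ (hC₂ (n - j))
          rw [mul_pow, mul_pow]
          have := norm_iteratedFDeriv_stftExp_le ξ (n - j) y
          have hA' : 0 ≤ A ^ (n - j) * 2 ^ (n - j) := by positivity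
          nlinarith [mul_le_mul_of_nonneg_left this hA']
        have hMM : M j * M (n - j) ≤ M n := by
          have := hM.mul_le j (n - j)
          rwa [Nat.add_sub_cancel' hjn] at this
        have hMj := hM.pos j
        have e3 := mul_le_mul e1 e2 (by positivity) (by positivity)
        have hpow : A ^ j * A ^ (n - j) = A ^ n := by rw [← pow_add, Nat.add_sub_cancel' hjn]
        have hpow2 : (2 : ℝ) ^ j * 2 ^ (n - j) = 2 ^ n := by
          rw [← pow_add, Nat.add_sub_cancel' hjn]
        have e4 : C₁ * M j / 2 ^ j * (C₂ * M (n - j) / 2 ^ (n - j)) ≤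
            C₁ * C₂ * M n / 2 ^ n := by
          rw [div_mul_div_comm, hpow2]
          have hCC : 0 ≤ C₁ * C₂ := by positivity
          have := mul_le_mul_of_nonneg_left hMM hCC
          refine div_le_div_of_nonneg_right ?_ (by positivity)
          linarith
        have e5 := e3.trans e4
        rw [← hpow]
        have hch : (0 : ℝ) ≤ n.choose j := by positivity
        have := mul_le_mul_of_nonneg_left e5 hch
        linarith
    _ = C₁ * C₂ * M n := by
        rw [← Finset.sum_mul]
        have : ∑ j ∈ Finset.range (n + 1), (n.choose j : ℝ) = 2 ^ n := by
          exact_mod_cast Nat.sum_range_choose n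
        rw [this]
        field_simp

/-- The function `y ↦ conj (φ (y - x)) e^{-i ⟨ξ, y⟩}` belongs to `𝓓^{(M_p)}` if `φ` does. -/
theorem stftAtom_mem_BeurlingD {M : ℕ → ℝ} (hM : IsDefiningSequence M) {d : ℕ}
    {φ : RSpace d → ℂ} (hφ : φ ∈ BeurlingD hM d) (x ξ : RSpace d) :
    stftAtom φ x ξ ∈ BeurlingD hM d := by
  refine ⟨stftAtom_mem_BeurlingE hM hφ.1 x ξ, ?_⟩
  have h1 : HasCompactSupport fun y => φ (y - x) := by
    have := hφ.2.comp_homeomorph (Homeomorph.subRight x)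
    exact this
  have h2 : HasCompactSupport fun y => (starRingEnd ℂ) (φ (y - x)) :=
    h1.comp_left (g := starRingEnd ℂ) (map_zero _)
  exact h2.mul_right

/-- The short-time Fourier transform of a linear functional `f` on `𝓔^{(M_p)}(ℝ^d)`,
`V_φ f (x, ξ) = (2π)^{-d/2} ∫ f(y) conj (φ (y - x)) e^{-i ⟨ξ, y⟩} dy`, where the integral stands for
the action of `f` in the variable `y`. -/
def stftE {M : ℕ → ℝ} (hM : IsDefiningSequence M) {d : ℕ} (f : BeurlingE hM d →ₗ[ℂ] ℂ)
    (φ : BeurlingE hM d) (x ξ : RSpace d) : ℂ :=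
  (((2 * Real.pi) ^ (-(d : ℝ) / 2) : ℝ) : ℂ) *
    f ⟨stftAtom φ x ξ, stftAtom_mem_BeurlingE hM φ.2 x ξ⟩

/-- The short-time Fourier transform of a linear functional `f` on `𝓓^{(M_p)}(ℝ^d)`, with the same
formula. -/
def stftD {M : ℕ → ℝ} (hM : IsDefiningSequence M) {d : ℕ} (f : BeurlingD hM d →ₗ[ℂ] ℂ)
    (φ : BeurlingD hM d) (x ξ : RSpace d) : ℂ :=
  (((2 * Real.pi) ^ (-(d : ℝ) / 2) : ℝ) : ℂ) *
    f ⟨stftAtom φ x ξ, stftAtom_mem_BeurlingD hM φ.2 x ξ⟩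

end

/-!
Let `u` be a continuous functional on `𝓔^{(M_p)}`, bounded by a seminorm `‖·‖_{M_p, A, K}`. The
atoms `conj φ(· - x) e^{-i⟨ξ, ·⟩}` are products, so by the Leibniz rule (`DerivBound.mul`, which
rests on `M_p M_q ≤ M_{p+q}`) their seminorms are at most the product of a bound for the translated
window on `K` and of `exp (M(2A|ξ|))` for the exponential. The window decays like
`exp (-M(a|y - x|))` for every `a` (`BeurlingS_exp_decay`), and (M.2) says that `h M(ρ) ≤ M(cρ) + C` for a suitable `c`
(`IsDefiningSequence.exists_exp_mul_assocFun_le`). This yields the growth estimates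
(`stftE_growth`); doubling trades the dilation in the last factor for a multiple.

For the characterization of compact support, one direction is clear: the atoms centred outside
`K - supp φ` vanish near `K`. Conversely, let `V_φ f (x, ·) = 0` for all `x` outside a ball.

* For such an `x` the functional `ψ ↦ f (conj φ(· - x) ψ)` on `𝓔^{(M_p)}` vanishes on all
  exponentials, so it vanishes on test functions (`BeurlingEDual_eq_zero_of_exp`): the Fourier
  inversion integral of a test function converges in every seminorm.
* Hence `f (|φ(· - x)|² ψ) = 0`. Since `∫ |φ(y - x)|² dx = ∫ |φ|²`, integrating over `x` in a large
  ball gives `(∫ |φ|²) f (ψ) = f (χ ψ)`, where `χ` is the integral of `|φ(· - x)|²` over the fixed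
  ball only. As `χ ∈ 𝓓^{(M_p)}`, the right-hand side makes sense for all `ψ ∈ 𝓔^{(M_p)}` and extends
  `f` (`belongsToEDual_of_stftD_eq_zero`). The window itself supplies the cutoff function `χ`.

Both steps take a functional under an integral. For this (`BeurlingEDual_apply_integral`) the space
`𝓔^{(M_p)}` with one of its seminorms is mapped to `ℓ^∞` by taking all weighted derivatives on `K`
(`jetMap`), the functional is extended to `ℓ^∞` by the Hahn-Banach theorem, and the Bochner integral
in `ℓ^∞` is identified coordinatewise by differentiation under the integral sign.
-/

noncomputable section

open Set Filter Topology MeasureTheory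
open scoped ContDiff FourierTransform

/-! ### The associated function -/

section AssocFun

variable {M : ℕ → ℝ}

theorem IsDefiningSequence.bddAbove_posLog (hM : IsDefiningSequence M) {ρ : ℝ} (hρ : 0 ≤ ρ) :
    BddAbove (range fun p : ℕ => Real.posLog (ρ ^ p * M 0 / M p)) := by
  obtain ⟨C, hC, h⟩ := hM.exists_pow_le hρ
  refine ⟨Real.posLog C, ?_⟩
  rintro _ ⟨p, rfl⟩
  have hp := hM.pos p
  refine Real.posLog_le_posLog (by rw [hM.zero]; positivity) ?_
  rw [hM.zero, mul_one, div_le_iff₀ hp]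
  exact h p

theorem assocFun_nonneg (M : ℕ → ℝ) (ρ : ℝ) : 0 ≤ assocFun M ρ :=
  Real.iSup_nonneg fun _ => Real.posLog_nonneg

theorem IsDefiningSequence.pow_le_mul_exp_assocFun (hM : IsDefiningSequence M) {ρ : ℝ}
    (hρ : 0 ≤ ρ) (p : ℕ) : ρ ^ p ≤ M p * Real.exp (assocFun M ρ) := by
  have hp := hM.pos p
  have h1 : Real.posLog (ρ ^ p * M 0 / M p) ≤ assocFun M ρ := le_ciSup (hM.bddAbove_posLog hρ) p
  rw [hM.zero, mul_one] at h1
  rw [← div_le_iff₀' hp]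
  exact (Real.le_exp_log _).trans (Real.exp_le_exp.2 (le_trans (le_max_right _ _) h1))

/-- `exp (M(ρ))` is the least upper bound of the numbers `ρ ^ p / M p` (the term `p = 0` being
`1`), in multiplicative form. -/
theorem IsDefiningSequence.mul_exp_assocFun_le (hM : IsDefiningSequence M) {ρ X Y : ℝ}
    (hρ : 0 ≤ ρ) (hX : 0 ≤ X) (h : ∀ p, X * ρ ^ p ≤ Y * M p) :
    X * Real.exp (assocFun M ρ) ≤ Y := by
  have h0 : X ≤ Y := by simpa [hM.zero] using h 0
  rcases hX.eq_or_lt with rfl | hX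
  · simpa using h0
  have hY : 0 < Y := hX.trans_le h0
  rw [← le_div_iff₀' hX, ← Real.le_log_iff_exp_le (div_pos hY hX)]
  refine ciSup_le fun p => ?_
  have hp := hM.pos p
  refine max_le (Real.log_nonneg ((one_le_div hX).2 h0)) ?_
  rcases (pow_nonneg hρ p).eq_or_lt with hr | hr
  · rw [← hr]
    simpa using Real.log_nonneg ((one_le_div hX).2 h0)
  · rw [hM.zero, mul_one]
    refine Real.log_le_log (by positivity) ?_
    rw [div_le_div_iff₀ hp hX, mul_comm]
    exact h p

theorem IsDefiningSequence.assocFun_mono (hM : IsDefiningSequence M) {ρ σ : ℝ} (hρ : 0 ≤ ρ)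
    (h : ρ ≤ σ) : assocFun M ρ ≤ assocFun M σ := by
  have := hM.mul_exp_assocFun_le hρ zero_le_one (Y := Real.exp (assocFun M σ)) fun p => by
    rw [one_mul, mul_comm]
    exact (pow_le_pow_left₀ hρ h p).trans (hM.pow_le_mul_exp_assocFun (hρ.trans h) p)
  rwa [one_mul, Real.exp_le_exp] at this

theorem IsDefiningSequence.assocFun_add_le (hM : IsDefiningSequence M) {s t : ℝ} (hs : 0 ≤ s)
    (ht : 0 ≤ t) : assocFun M (s + t) ≤ assocFun M (2 * s) + assocFun M (2 * t) := by
  rcases le_total s t with h | h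
  · have := hM.assocFun_mono (add_nonneg hs ht) (show s + t ≤ 2 * t by linarith)
    linarith [assocFun_nonneg M (2 * s)]
  · have := hM.assocFun_mono (add_nonneg hs ht) (show s + t ≤ 2 * s by linarith)
    linarith [assocFun_nonneg M (2 * t)]

/-- Condition (M.2) in terms of the associated function: `2 M(ρ) ≤ M(Hρ) + log A`. -/
theorem IsDefiningSequence.exists_exp_two_mul_assocFun_le (hM : IsDefiningSequence M) :
    ∃ A > 0, ∃ H > 0, ∀ ρ, 0 ≤ ρ →
      Real.exp (2 * assocFun M ρ) ≤ A * Real.exp (assocFun M (H * ρ)) := by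
  obtain ⟨A, hA, H, hH, h⟩ := hM.m2
  refine ⟨A, hA, H, hH, fun ρ hρ => ?_⟩
  set E := Real.exp (assocFun M (H * ρ))
  have key : ∀ p q, ρ ^ q * ρ ^ p ≤ A * M q * E * M p := by
    intro p q
    have h1 := hM.pow_le_mul_exp_assocFun (mul_nonneg hH.le hρ) (p + q)
    have h2 := mul_le_mul_of_nonneg_right (h p q) (Real.exp_pos (assocFun M (H * ρ))).le
    have h3 := h1.trans h2
    rw [mul_pow] at h3
    have hHp : 0 < H ^ (p + q) := pow_pos hH _
    refine le_of_mul_le_mul_left ?_ hHp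
    calc H ^ (p + q) * (ρ ^ q * ρ ^ p) = H ^ (p + q) * ρ ^ (p + q) := by ring
      _ ≤ _ := h3
      _ = _ := by ring
  have h1 : ∀ q, Real.exp (assocFun M ρ) * ρ ^ q ≤ A * E * M q := fun q => by
    have := hM.mul_exp_assocFun_le hρ (pow_nonneg hρ q) fun p => key p q
    linarith
  have h2 := hM.mul_exp_assocFun_le hρ (Real.exp_pos _).le h1
  rwa [two_mul, Real.exp_add]

/-- Multiples of the associated function are absorbed by dilations. -/
theorem IsDefiningSequence.exists_exp_mul_assocFun_le (hM : IsDefiningSequence M) (h : ℝ) :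
    ∃ c > 0, ∃ C > 0, ∀ ρ, 0 ≤ ρ →
      Real.exp (h * assocFun M ρ) ≤ C * Real.exp (assocFun M (c * ρ)) := by
  obtain ⟨A, hA, H, hH, hAH⟩ := hM.exists_exp_two_mul_assocFun_le
  have key : ∀ k : ℕ, ∃ c > 0, ∃ C > 0, ∀ ρ, 0 ≤ ρ →
      Real.exp (2 ^ k * assocFun M ρ) ≤ C * Real.exp (assocFun M (c * ρ)) := by
    intro k
    induction k with
    | zero => exact ⟨1, one_pos, 1, one_pos, fun ρ _ => by simp⟩
    | succ k ih =>
      obtain ⟨c, hc, C, hC, hk⟩ := ih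
      refine ⟨H * c, mul_pos hH hc, C ^ 2 * A, by positivity, fun ρ hρ => ?_⟩
      calc Real.exp (2 ^ (k + 1) * assocFun M ρ) = Real.exp (2 ^ k * assocFun M ρ) ^ 2 := by
            rw [← Real.exp_nat_mul]; congr 1; push_cast; ring
        _ ≤ (C * Real.exp (assocFun M (c * ρ))) ^ 2 :=
            pow_le_pow_left₀ (Real.exp_pos _).le (hk ρ hρ) 2
        _ = C ^ 2 * Real.exp (2 * assocFun M (c * ρ)) := by
            rw [mul_pow, ← Real.exp_nat_mul]; push_cast; rfl
        _ ≤ C ^ 2 * (A * Real.exp (assocFun M (H * (c * ρ)))) := by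
            gcongr; exact hAH _ (by positivity)
        _ = _ := by rw [mul_assoc H c ρ]; ring
  obtain ⟨k, hk⟩ := pow_unbounded_of_one_lt h (one_lt_two (α := ℝ))
  obtain ⟨c, hc, C, hC, H'⟩ := key k
  refine ⟨c, hc, C, hC, fun ρ hρ => le_trans (Real.exp_le_exp.2 ?_) (H' ρ hρ)⟩
  exact mul_le_mul_of_nonneg_right hk.le (assocFun_nonneg M ρ)

/-- For a doubling associated function, conversely, dilations are absorbed by multiples. -/
theorem IsDefiningSequence.exists_exp_assocFun_mul_le (hM : IsDefiningSequence M)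
    (hd : AssocDoubling M) {c : ℝ} (hc : 0 ≤ c) :
    ∃ ε > 0, ∃ C > 0, ∀ ρ, 0 ≤ ρ →
      Real.exp (assocFun M (c * ρ)) ≤ C * Real.exp (ε * assocFun M ρ) := by
  obtain ⟨L, D, h⟩ := hd
  have key : ∀ k : ℕ, ∃ ε > 0, ∃ E, ∀ ρ, 0 < ρ →
      assocFun M (2 ^ k * ρ) ≤ ε * assocFun M ρ + E := by
    intro k
    induction k with
    | zero => exact ⟨1, one_pos, 0, fun ρ _ => by simp⟩
    | succ k ih =>
      obtain ⟨ε, hε, E, hk⟩ := ih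
      refine ⟨max L 1 * ε, by positivity, max L 1 * E + D, fun ρ hρ => ?_⟩
      have h1 := h (2 ^ k * ρ) (by positivity)
      have h2 : L * assocFun M (2 ^ k * ρ) ≤ max L 1 * assocFun M (2 ^ k * ρ) :=
        mul_le_mul_of_nonneg_right (le_max_left _ _) (assocFun_nonneg _ _)
      have h3 := mul_le_mul_of_nonneg_left (hk ρ hρ) (show 0 ≤ max L 1 by positivity)
      rw [pow_succ', mul_assoc]
      linarith
  obtain ⟨k, hk⟩ := pow_unbounded_of_one_lt c (one_lt_two (α := ℝ))
  obtain ⟨ε, hε, E, hE⟩ := key k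
  refine ⟨ε, hε, Real.exp (max E 0), Real.exp_pos _, fun ρ hρ => ?_⟩
  rw [← Real.exp_add, Real.exp_le_exp]
  rcases hρ.eq_or_lt with rfl | hρ'
  · have h0 : assocFun M 0 = 0 := by
      refine le_antisymm ?_ (assocFun_nonneg _ _)
      have := hM.mul_exp_assocFun_le le_rfl zero_le_one (Y := 1) fun p => by
        rcases p with _ | p
        · simp [hM.zero]
        · simpa using (hM.pos _).le
      rw [one_mul] at this
      simpa using Real.exp_le_one_iff.1 this
    simp [h0]
  · have h1 := hM.assocFun_mono (mul_nonneg hc hρ) (mul_le_mul_of_nonneg_right hk.le hρ)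
    linarith [hE ρ hρ', le_max_left E 0]

end AssocFun

/-! ### Bounds for all derivatives -/

/-- `‖D^n φ (y)‖ ≤ C M_n / A ^ n` for all `n` and all `y ∈ K`, where `D^n φ` is the full `n`-th
derivative with its operator norm. Up to a change of `A` by the factor `d + 1`, this says that
`‖φ‖_{M_p, A, K} ≤ C`; the operator norm is more convenient for the Leibniz rule. -/
def DerivBound (M : ℕ → ℝ) {d : ℕ} (A C : ℝ) (K : Set (RSpace d)) (φ : RSpace d → ℂ) : Prop :=
  ∀ n : ℕ, ∀ y ∈ K, ‖iteratedFDeriv ℝ n φ y‖ ≤ C * M n / A ^ n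

section DerivBound

variable {M : ℕ → ℝ} {d : ℕ} {A C D : ℝ} {K : Set (RSpace d)} {φ ψ : RSpace d → ℂ}

theorem DerivBound.mem_ultraValues_le (hM : IsDefiningSequence M) (hA : 0 < A)
    (h : DerivBound M A C K φ) {r : ℝ} (hr : r ∈ ultraValues M A K φ) : r ≤ C := by
  obtain ⟨n, i, y, hy, rfl⟩ := hr
  have hn := hM.pos n
  have h1 := (norm_mixedPartial_le i φ y).trans (h n y hy)
  rw [le_div_iff₀ (by positivity)] at h1
  rw [div_mul_eq_mul_div, div_le_iff₀ hn]
  linarith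

theorem DerivBound.bddAbove (hM : IsDefiningSequence M) (hA : 0 < A)
    (h : DerivBound M A C K φ) : BddAbove (ultraValues M A K φ) :=
  ⟨C, fun _ hr => h.mem_ultraValues_le hM hA hr⟩

theorem DerivBound.ultraNorm_le (hM : IsDefiningSequence M) (hA : 0 < A) (hC : 0 ≤ C)
    (h : DerivBound M A C K φ) : ultraNorm M A K φ ≤ C :=
  Real.sSup_le (fun _ hr => h.mem_ultraValues_le hM hA hr) hC

theorem ultraNorm_nonneg (hM : IsDefiningSequence M) (hA : 0 < A) : 0 ≤ ultraNorm M A K φ := by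
  refine Real.sSup_nonneg ?_
  rintro r ⟨n, i, y, -, rfl⟩
  have := hM.pos n
  positivity

theorem derivBound_ultraNorm (hM : IsDefiningSequence M) (hφ : φ ∈ BeurlingE hM d)
    (hK : IsCompact K) (hA : 0 < A) :
    DerivBound M A (ultraNorm M ((d + 1) * A) K φ) K φ := by
  intro n y hy
  have hn := hM.pos n
  have hA' : 0 < (d + 1) * A := by positivity
  have hN : 0 ≤ ultraNorm M ((d + 1) * A) K φ := ultraNorm_nonneg hM hA'
  have h1 : ∀ i : Fin n → Fin d,
      ‖mixedPartial i φ y‖ ≤ ultraNorm M ((d + 1) * A) K φ * M n / ((d + 1) * A) ^ n := by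
    intro i
    have h2 : ((d + 1) * A) ^ n / M n * ‖mixedPartial i φ y‖ ≤ ultraNorm M ((d + 1) * A) K φ :=
      le_csSup (hφ.2 K hK _ hA') ⟨n, i, y, hy, rfl⟩
    rw [div_mul_eq_mul_div, div_le_iff₀ hn] at h2
    rw [le_div_iff₀ (by positivity)]
    linarith
  refine (norm_iteratedFDeriv_le_of_mixedPartial (by positivity) h1).trans ?_
  rw [mul_pow, mul_div_assoc', div_le_div_iff₀ (by positivity) (by positivity)]
  have h3 : (d : ℝ) ^ n ≤ (d + 1 : ℝ) ^ n := by gcongr; linarith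
  have h4 : 0 ≤ ultraNorm M ((d + 1) * A) K φ * M n * A ^ n := by positivity
  nlinarith [mul_le_mul_of_nonneg_right h3 h4]

theorem DerivBound.mono_left (hM : IsDefiningSequence M) {B : ℝ} (hA : 0 < A) (hAB : A ≤ B)
    (hC : 0 ≤ C) (h : DerivBound M B C K φ) : DerivBound M A C K φ := fun n y hy => by
  have := hM.pos n
  refine (h n y hy).trans ?_
  gcongr

/-- The Leibniz rule; (M.1) enters through `M_p M_q ≤ M_{p+q}`. -/
theorem DerivBound.mul (hM : IsDefiningSequence M) (hA : 0 < A) (hC : 0 ≤ C) (hD : 0 ≤ D)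
    (hφ : ContDiff ℝ ∞ φ) (hψ : ContDiff ℝ ∞ ψ)
    (h1 : DerivBound M (2 * A) C K φ) (h2 : DerivBound M (2 * A) D K ψ) :
    DerivBound M A (C * D) K (fun y => φ y * ψ y) := by
  intro n y hy
  refine (norm_iteratedFDeriv_mul_le (𝕜 := ℝ) hφ hψ y (n := n)
    (by exact_mod_cast le_top)).trans ?_
  have hn := hM.pos n
  calc _ ≤ ∑ j ∈ Finset.range (n + 1), (n.choose j : ℝ) * (C * D * M n / (2 * A) ^ n) := by
        refine Finset.sum_le_sum fun j hj => ?_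
        have hjn : j ≤ n := by simpa [Nat.lt_succ_iff] using hj
        have e1 := h1 j y hy
        have e2 := h2 (n - j) y hy
        have hMM : M j * M (n - j) ≤ M n := by
          have := hM.mul_le j (n - j)
          rwa [Nat.add_sub_cancel' hjn] at this
        have hMj := hM.pos j
        have e3 := mul_le_mul e1 e2 (norm_nonneg _) (by positivity)
        rw [div_mul_div_comm, ← pow_add, Nat.add_sub_cancel' hjn] at e3
        rw [mul_assoc]
        refine mul_le_mul_of_nonneg_left (e3.trans ?_) (by positivity)
        refine div_le_div_of_nonneg_right ?_ (by positivity)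
        nlinarith [mul_le_mul_of_nonneg_left hMM (mul_nonneg hC hD)]
    _ = C * D * M n / A ^ n := by
        rw [← Finset.sum_mul]
        have : ∑ j ∈ Finset.range (n + 1), (n.choose j : ℝ) = 2 ^ n := by
          exact_mod_cast Nat.sum_range_choose n
        rw [this, mul_pow]
        field_simp

theorem norm_iteratedFDeriv_conj_comp_sub (φ : RSpace d → ℂ) (x : RSpace d) (n : ℕ)
    (y : RSpace d) : ‖iteratedFDeriv ℝ n (fun y => (starRingEnd ℂ) (φ (y - x))) y‖ =
      ‖iteratedFDeriv ℝ n φ (y - x)‖ := by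
  have h1 := LinearIsometryEquiv.norm_iteratedFDeriv_comp_left (𝕜 := ℝ) Complex.conjLIE
    (fun y => φ (y - x)) y n
  have h2 : (Complex.conjLIE ∘ fun y => φ (y - x)) = fun y => (starRingEnd ℂ) (φ (y - x)) := by
    funext y; simp
  rw [h2] at h1
  rw [h1, iteratedFDeriv_comp_sub]

theorem mem_BeurlingE_of_derivBound (hM : IsDefiningSequence M) (hφ : ContDiff ℝ ∞ φ)
    (h : ∀ K : Set (RSpace d), IsCompact K → ∀ A : ℝ, 0 < A → ∃ C, DerivBound M A C K φ) :
    φ ∈ BeurlingE hM d :=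
  ⟨hφ, fun K hK A hA => (h K hK A hA).choose_spec.bddAbove hM hA⟩

theorem mul_mem_BeurlingE (hM : IsDefiningSequence M) (hφ : φ ∈ BeurlingE hM d)
    (hψ : ψ ∈ BeurlingE hM d) : (fun y => φ y * ψ y) ∈ BeurlingE hM d :=
  mem_BeurlingE_of_derivBound hM (hφ.1.mul hψ.1) fun K hK A hA => by
    have h2 : 0 < 2 * A := by positivity
    exact ⟨_, (derivBound_ultraNorm hM hφ hK h2).mul hM hA
      (ultraNorm_nonneg hM (by positivity)) (ultraNorm_nonneg hM (by positivity)) hφ.1 hψ.1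
      (derivBound_ultraNorm hM hψ hK h2)⟩

theorem ultraNorm_mul_le (hM : IsDefiningSequence M) (hφ : φ ∈ BeurlingE hM d)
    (hψ : ψ ∈ BeurlingE hM d) (hK : IsCompact K) (hA : 0 < A) :
    ultraNorm M A K (fun y => φ y * ψ y) ≤
      ultraNorm M ((d + 1) * (2 * A)) K φ * ultraNorm M ((d + 1) * (2 * A)) K ψ := by
  have h2 : 0 < 2 * A := by positivity
  have h3 : ∀ χ : RSpace d → ℂ, 0 ≤ ultraNorm M ((d + 1) * (2 * A)) K χ :=
    fun χ => ultraNorm_nonneg hM (by positivity)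
  exact ((derivBound_ultraNorm hM hφ hK h2).mul hM hA (h3 _) (h3 _) hφ.1 hψ.1
      (derivBound_ultraNorm hM hψ hK h2)).ultraNorm_le hM hA (mul_nonneg (h3 _) (h3 _))

/-- A compactly supported element of `𝓔^{(M_p)}` satisfies its derivative bounds globally. -/
theorem exists_derivBound_univ (hM : IsDefiningSequence M) (hφ : φ ∈ BeurlingD hM d)
    (hA : 0 < A) : ∃ C, 0 ≤ C ∧ DerivBound M A C univ φ := by
  refine ⟨ultraNorm M ((d + 1) * A) (tsupport φ) φ, ultraNorm_nonneg hM (by positivity),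
    fun n y _ => ?_⟩
  by_cases hy : y ∈ tsupport φ
  · exact derivBound_ultraNorm hM hφ.1 hφ.2 hA n y hy
  · have h0 : iteratedFDeriv ℝ n φ y = 0 :=
      image_eq_zero_of_notMem_tsupport fun h => hy (tsupport_iteratedFDeriv_subset n h)
    have := hM.pos n
    have := ultraNorm_nonneg hM (K := tsupport φ) (φ := φ) (show 0 < (d + 1) * A by positivity)
    rw [h0, norm_zero]
    positivity

end DerivBound

/-! ### The short-time Fourier transform of a functional on `𝓔^{(M_p)}` -/

theorem exists_norm_le_mul_abs_apply {d : ℕ} {z : RSpace d} (hz : z ≠ 0) :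
    ∃ j, ‖z‖ ≤ (d + 1) * |z j| := by
  by_contra! h
  have h1 : z = ∑ j : Fin d, z j • EuclideanSpace.single j (1 : ℝ) := by
    ext l
    simp [Finset.sum_apply, Pi.single_apply]
  have h2 : ‖z‖ ≤ ∑ j, |z j| := by
    conv_lhs => rw [h1]
    refine (norm_sum_le _ _).trans (Finset.sum_le_sum fun j _ => ?_)
    simp [norm_smul]
  have h3 : ∀ j, |z j| ≤ ‖z‖ / (d + 1) := fun j => by
    rw [le_div_iff₀ (by positivity)]
    linarith [h j]
  have h4 : ‖z‖ ≤ d * (‖z‖ / (d + 1)) :=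
    h2.trans ((Finset.sum_le_sum fun j _ => h3 j).trans (by simp))
  have h5 : 0 < ‖z‖ := norm_pos_iff.2 hz
  rw [mul_div_assoc', le_div_iff₀ (by positivity)] at h4
  linarith

/-- The derivatives of an element of `𝓢^{(M_p)}` decay like `exp (-M(a |z|))` for every `a`: the
infimum over `α` of the defining estimates. -/
theorem BeurlingS_exp_decay {M : ℕ → ℝ} (hM : IsDefiningSequence M) {d : ℕ} {φ : RSpace d → ℂ}
    (hφ : φ ∈ BeurlingS M d) {a A : ℝ} (ha : 0 < a) (hA : 0 < A) :
    ∃ C > 0, ∀ (n : ℕ) (z : RSpace d),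
      ‖iteratedFDeriv ℝ n φ z‖ * Real.exp (assocFun M (a * ‖z‖)) ≤ C * M n / A ^ n := by
  obtain ⟨C, hC, h⟩ := hφ.2 (((d + 1) * a)⁻¹) (by positivity) (((d + 1) * A)⁻¹) (by positivity)
  refine ⟨C, hC, fun n z => ?_⟩
  have hn := hM.pos n
  refine hM.mul_exp_assocFun_le (by positivity) (norm_nonneg _) fun m => ?_
  have hm := hM.pos m
  rcases Nat.eq_zero_or_pos m with rfl | hm0
  · have h1 : ∀ i : Fin n → Fin d, ‖mixedPartial i φ z‖ ≤ C * (((d + 1) * A)⁻¹) ^ n * M n :=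
      fun i => by simpa [hM.zero] using h (fun _ => 0) n i z
    refine (le_of_eq (by simp)).trans
      ((norm_iteratedFDeriv_le_of_mixedPartial (by positivity) h1).trans ?_)
    rw [hM.zero, mul_one, inv_pow, mul_pow]
    have : (d : ℝ) ^ n ≤ (d + 1 : ℝ) ^ n := by gcongr; linarith
    calc (d : ℝ) ^ n * (C * ((d + 1 : ℝ) ^ n * A ^ n)⁻¹ * M n)
        ≤ (d + 1 : ℝ) ^ n * (C * ((d + 1 : ℝ) ^ n * A ^ n)⁻¹ * M n) := by gcongr
      _ = C * M n / A ^ n := by field_simp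
  rcases eq_or_ne z 0 with rfl | hz
  · rw [norm_zero, mul_zero, zero_pow hm0.ne', mul_zero]
    positivity
  obtain ⟨j, hj⟩ := exists_norm_le_mul_abs_apply hz
  have hzj : 0 < |z j| := by
    have := norm_pos_iff.2 hz
    by_contra h0
    nlinarith [abs_nonneg (z j), show (0 : ℝ) ≤ d by positivity]
  have h1 : ∀ i : Fin n → Fin d, ‖mixedPartial i φ z‖ ≤
      C * (((d + 1) * a)⁻¹) ^ m * M m * (((d + 1) * A)⁻¹) ^ n * M n / |z j| ^ m := by
    intro i
    have h2 := h (Pi.single j m) n i z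
    have h3 : ∏ k, |z k| ^ (Pi.single j m : Fin d → ℕ) k = |z j| ^ m := by
      rw [Finset.prod_eq_single j]
      · simp
      · intro b _ hb
        simp [Pi.single_eq_of_ne hb]
      · simp
    have h4 : ∑ k, (Pi.single j m : Fin d → ℕ) k = m := by simp
    rw [h3, h4] at h2
    rw [le_div_iff₀ (by positivity)]
    linarith
  have h5 := norm_iteratedFDeriv_le_of_mixedPartial (by positivity) h1
  have hd : (d : ℝ) ^ n ≤ (d + 1 : ℝ) ^ n := by gcongr; linarith
  calc ‖iteratedFDeriv ℝ n φ z‖ * (a * ‖z‖) ^ m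
      ≤ ((d + 1 : ℝ) ^ n * (C * (((d + 1) * a)⁻¹) ^ m * M m * (((d + 1) * A)⁻¹) ^ n * M n /
          |z j| ^ m)) * (a * ((d + 1) * |z j|)) ^ m := by
        gcongr
        refine h5.trans ?_
        gcongr
    _ = C * M n / A ^ n * M m := by
        simp only [mul_pow, inv_pow]
        field_simp

/-- The exponential `e^{-i ⟨ξ, ·⟩}` in `𝓔^{(M_p)}`, with its growth in `ξ`. -/
theorem derivBound_stftExp {M : ℕ → ℝ} (hM : IsDefiningSequence M) {d : ℕ} (ξ : RSpace d) {A : ℝ}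
    (hA : 0 < A) (K : Set (RSpace d)) :
    DerivBound M A (Real.exp (assocFun M (A * ‖ξ‖))) K
      fun y => Complex.exp (-Complex.I * ((inner ℝ ξ y : ℝ) : ℂ)) := fun n y _ => by
  refine (norm_iteratedFDeriv_stftExp_le ξ n y).trans ?_
  rw [le_div_iff₀ (by positivity), ← mul_pow, mul_comm ‖ξ‖, mul_comm (Real.exp _)]
  exact hM.pow_le_mul_exp_assocFun (by positivity) n

theorem stftE_growth {M : ℕ → ℝ} (hM : IsDefiningSequence M) {d : ℕ}
    {f : BeurlingE hM d →ₗ[ℂ] ℂ} (hf : f ∈ BeurlingEDual hM d) {φ : RSpace d → ℂ}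
    (hφ : φ ∈ BeurlingS M d) :
    ∃ ε : ℝ, 0 < ε ∧ ∀ h : ℝ, 0 < h → ∃ C : ℝ, 0 < C ∧ ∀ x ξ : RSpace d,
      ‖stftE hM f ⟨φ, BeurlingS_subset_BeurlingE hM hφ⟩ x ξ‖ ≤
        C * (Real.exp (-h * assocFun M ‖x‖) * Real.exp (assocFun M (ε * ‖ξ‖))) := by
  obtain ⟨K, hK, A, hA, C₀, hf⟩ := hf
  obtain ⟨R, hR0, hR⟩ := hK.isBounded.exists_pos_norm_le
  refine ⟨2 * A, by positivity, fun h _ => ?_⟩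
  obtain ⟨c, hc, C₁, hC₁, h1⟩ := hM.exists_exp_mul_assocFun_le h
  obtain ⟨C₂, hC₂, h2⟩ := BeurlingS_exp_decay hM hφ (a := 2 * c) (A := 2 * A)
    (by positivity) (by positivity)
  set C₃ := C₁ * C₂ * Real.exp (assocFun M (2 * (c * R))) with hC₃
  have hC₃0 : 0 < C₃ := by positivity
  -- `|x| ≤ |y - x| + R` for `y ∈ K` transfers the decay of the window to the variable `x`.
  have h3 : ∀ x, DerivBound M (2 * A) (C₃ * Real.exp (-h * assocFun M ‖x‖)) K
      (fun y => (starRingEnd ℂ) (φ (y - x))) := by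
    intro x n y hy
    have hn := hM.pos n
    rw [norm_iteratedFDeriv_conj_comp_sub]
    have e1 : assocFun M (c * ‖x‖) ≤
        assocFun M (2 * c * ‖y - x‖) + assocFun M (2 * (c * R)) := by
      have t1 : ‖x‖ ≤ ‖y - x‖ + R := by
        have := norm_sub_norm_le x y
        rw [norm_sub_rev] at this
        linarith [hR y hy]
      have t2 := hM.assocFun_mono (by positivity) (mul_le_mul_of_nonneg_left t1 hc.le)
      rw [mul_add] at t2
      have t3 := hM.assocFun_add_le (s := c * ‖y - x‖) (t := c * R) (by positivity) (by positivity)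
      rw [← mul_assoc 2 c] at t3
      exact t2.trans t3
    have e2 := h1 ‖x‖ (norm_nonneg x)
    have e3 : Real.exp (h * assocFun M ‖x‖) ≤ C₁ * (Real.exp (assocFun M (2 * c * ‖y - x‖)) *
        Real.exp (assocFun M (2 * (c * R)))) := by
      refine e2.trans ?_
      rw [← Real.exp_add]
      gcongr
    have e4 := h2 n (y - x)
    rw [neg_mul, Real.exp_neg]
    have hx := Real.exp_pos (h * assocFun M ‖x‖)
    rw [← mul_le_mul_iff_left₀ hx]
    calc ‖iteratedFDeriv ℝ n φ (y - x)‖ * Real.exp (h * assocFun M ‖x‖)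
        ≤ ‖iteratedFDeriv ℝ n φ (y - x)‖ * (C₁ * (Real.exp (assocFun M (2 * c * ‖y - x‖)) *
            Real.exp (assocFun M (2 * (c * R))))) := by gcongr
      _ = C₁ * Real.exp (assocFun M (2 * (c * R))) * (‖iteratedFDeriv ℝ n φ (y - x)‖ *
            Real.exp (assocFun M (2 * c * ‖y - x‖))) := by ring
      _ ≤ C₁ * Real.exp (assocFun M (2 * (c * R))) * (C₂ * M n / (2 * A) ^ n) := by gcongr
      _ = C₃ * (Real.exp (h * assocFun M ‖x‖))⁻¹ * M n / (2 * A) ^ n *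
            Real.exp (h * assocFun M ‖x‖) := by
          rw [hC₃]; field_simp
  set p : ℝ := (2 * Real.pi) ^ (-(d : ℝ) / 2)
  have hp : 0 < p := Real.rpow_pos_of_pos (by positivity) _
  refine ⟨p * (|C₀| + 1) * C₃, by positivity, fun x ξ => ?_⟩
  have hφx : ContDiff ℝ ∞ fun y => (starRingEnd ℂ) (φ (y - x)) :=
    Complex.conjCLE.contDiff.comp (hφ.1.comp (contDiff_id.sub contDiff_const))
  have h4 : ultraNorm M A K (stftAtom φ x ξ) ≤ _ :=
    ((h3 x).mul hM hA (by positivity) (Real.exp_pos _).le hφx (contDiff_stftExp ξ)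
      (derivBound_stftExp hM ξ (by positivity) K)).ultraNorm_le hM hA (by positivity)
  have h5 := hf ⟨stftAtom φ x ξ,
    stftAtom_mem_BeurlingE hM (BeurlingS_subset_BeurlingE hM hφ) x ξ⟩
  have h6 : 0 ≤ ultraNorm M A K (stftAtom φ x ξ) := ultraNorm_nonneg hM hA
  unfold stftE
  rw [norm_mul, Complex.norm_real, Real.norm_of_nonneg hp.le, mul_assoc, mul_assoc]
  refine mul_le_mul_of_nonneg_left (h5.trans ?_) hp.le
  calc C₀ * ultraNorm M A K (stftAtom φ x ξ)
      ≤ (|C₀| + 1) * ultraNorm M A K (stftAtom φ x ξ) := by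
        gcongr; linarith [le_abs_self C₀]
    _ ≤ (|C₀| + 1) * _ := mul_le_mul_of_nonneg_left h4 (by positivity)
    _ = _ := by ring

theorem stftE_growth_of_doubling {M : ℕ → ℝ} (hM : IsDefiningSequence M) {d : ℕ}
    {f : BeurlingE hM d →ₗ[ℂ] ℂ} (hf : f ∈ BeurlingEDual hM d) {φ : RSpace d → ℂ}
    (hφ : φ ∈ BeurlingS M d) (hd : AssocDoubling M) :
    ∃ ε : ℝ, 0 < ε ∧ ∀ h : ℝ, 0 < h → ∃ C : ℝ, 0 < C ∧ ∀ x ξ : RSpace d,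
      ‖stftE hM f ⟨φ, BeurlingS_subset_BeurlingE hM hφ⟩ x ξ‖ ≤
        C * (Real.exp (-h * assocFun M ‖x‖) * Real.exp (ε * assocFun M ‖ξ‖)) := by
  obtain ⟨ε, hε, H⟩ := stftE_growth hM hf hφ
  obtain ⟨δ, hδ, D, hD, h1⟩ := hM.exists_exp_assocFun_mul_le hd hε.le
  refine ⟨δ, hδ, fun h hh => ?_⟩
  obtain ⟨C, hC, h2⟩ := H h hh
  refine ⟨C * D, by positivity, fun x ξ => (h2 x ξ).trans ?_⟩
  calc C * (Real.exp (-h * assocFun M ‖x‖) * Real.exp (assocFun M (ε * ‖ξ‖)))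
      ≤ C * (Real.exp (-h * assocFun M ‖x‖) * (D * Real.exp (δ * assocFun M ‖ξ‖))) := by
        gcongr; exact h1 _ (norm_nonneg ξ)
    _ = _ := by ring

theorem BeurlingD_subset_BeurlingS {M : ℕ → ℝ} (hM : IsDefiningSequence M) {d : ℕ}
    {φ : RSpace d → ℂ} (hφ : φ ∈ BeurlingD hM d) : φ ∈ BeurlingS M d := by
  refine ⟨hφ.1.1, fun A hA B hB => ?_⟩
  obtain ⟨R, hR0, hR⟩ := hφ.2.isCompact.isBounded.exists_pos_norm_le
  obtain ⟨C₁, hC₁, h1⟩ := exists_derivBound_univ hM hφ (inv_pos.2 hB)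
  obtain ⟨C₂, hC₂, h2⟩ := hM.exists_pow_le (r := R / A) (by positivity)
  refine ⟨(C₁ + 1) * C₂, by positivity, fun α n i x => ?_⟩
  have hn := hM.pos n
  have hm := hM.pos (∑ j, α j)
  by_cases hx : x ∈ tsupport φ
  · have e1 : ∏ j, |x j| ^ α j ≤ A ^ (∑ j, α j) * (C₂ * M (∑ j, α j)) := by
      have e2 := h2 (∑ j, α j)
      rw [div_pow, div_le_iff₀ (by positivity)] at e2
      calc ∏ j, |x j| ^ α j ≤ ∏ j, R ^ α j := by
            refine Finset.prod_le_prod (fun _ _ => by positivity) fun j _ => ?_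
            exact pow_le_pow_left₀ (abs_nonneg _)
              ((PiLp.norm_apply_le x j).trans (hR x hx)) _
        _ = R ^ ∑ j, α j := Finset.prod_pow_eq_pow_sum _ _ _
        _ ≤ _ := e2
        _ = _ := by ring
    have e3 : ‖mixedPartial i φ x‖ ≤ (C₁ + 1) * (B ^ n * M n) := by
      refine (norm_mixedPartial_le i φ x).trans ((h1 n x (mem_univ x)).trans ?_)
      rw [inv_pow, div_inv_eq_mul]
      nlinarith [mul_pos (pow_pos hB n) hn]
    calc _ ≤ A ^ (∑ j, α j) * (C₂ * M (∑ j, α j)) * ((C₁ + 1) * (B ^ n * M n)) :=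
          mul_le_mul e1 e3 (norm_nonneg _) (by positivity)
      _ = _ := by ring
  · have h0 : iteratedFDeriv ℝ n φ x = 0 :=
      image_eq_zero_of_notMem_tsupport fun h => hx (tsupport_iteratedFDeriv_subset n h)
    rw [show mixedPartial i φ x = 0 by rw [mixedPartial, h0]; rfl, norm_zero, mul_zero]
    positivity

/-! ### Integrals of families in `𝓔^{(M_p)}` -/

section ParametricIntegral

variable {d : ℕ} {X : Type*} [TopologicalSpace X] [MeasurableSpace X] [OpensMeasurableSpace X]
  {μ : Measure X} {F : X → RSpace d → ℂ}

theorem hasFDerivAt_iteratedFDeriv_apply {φ : RSpace d → ℂ} (hφ : ContDiff ℝ ∞ φ) (n : ℕ)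
    (v : Fin n → RSpace d) (y : RSpace d) :
    HasFDerivAt (fun y => iteratedFDeriv ℝ n φ y v)
      (fderiv ℝ (fun y => iteratedFDeriv ℝ n φ y v) y) y :=
  (((ContinuousMultilinearMap.apply ℝ (fun _ : Fin n => RSpace d) ℂ v).differentiable.comp
    (hφ.differentiable_iteratedFDeriv (m := n)
      (by exact_mod_cast WithTop.coe_lt_top n))) y).hasFDerivAt

theorem fderiv_iteratedFDeriv_apply {φ : RSpace d → ℂ} (hφ : ContDiff ℝ ∞ φ) (n : ℕ)
    (v : Fin n → RSpace d) (y w : RSpace d) :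
    fderiv ℝ (fun y => iteratedFDeriv ℝ n φ y v) y w =
      iteratedFDeriv ℝ (n + 1) φ y (Fin.cons w v : Fin (n + 1) → RSpace d) := by
  have h1 : HasFDerivAt (fun y => iteratedFDeriv ℝ n φ y v)
      ((ContinuousMultilinearMap.apply ℝ (fun _ : Fin n => RSpace d) ℂ v).comp
        (fderiv ℝ (iteratedFDeriv ℝ n φ) y)) y :=
    (ContinuousMultilinearMap.apply ℝ (fun _ : Fin n => RSpace d) ℂ v).hasFDerivAt.comp y
      ((hφ.differentiable_iteratedFDeriv (m := n)
        (by exact_mod_cast WithTop.coe_lt_top n)) y).hasFDerivAt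
  rw [h1.fderiv, iteratedFDeriv_succ_apply_left]
  simp

theorem norm_fderiv_iteratedFDeriv_apply_le {φ : RSpace d → ℂ} (hφ : ContDiff ℝ ∞ φ) (n : ℕ)
    (v : Fin n → RSpace d) (y : RSpace d) :
    ‖fderiv ℝ (fun y => iteratedFDeriv ℝ n φ y v) y‖ ≤
      ‖iteratedFDeriv ℝ (n + 1) φ y‖ * ∏ k, ‖v k‖ := by
  refine ContinuousLinearMap.opNorm_le_bound _ (by positivity) fun w => ?_
  rw [fderiv_iteratedFDeriv_apply hφ]
  refine (ContinuousMultilinearMap.le_opNorm _ _).trans (le_of_eq ?_)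
  rw [Fin.prod_univ_succ]
  simp only [Fin.cons_zero, Fin.cons_succ]
  ring

theorem integrable_iteratedFDeriv_apply
    (hc : ∀ n, Continuous fun p : X × RSpace d => iteratedFDeriv ℝ n (F p.1) p.2)
    {g : ℕ → X → ℝ} (hg : ∀ n, Integrable (g n) μ)
    (hb : ∀ n x y, ‖iteratedFDeriv ℝ n (F x) y‖ ≤ g n x) (n : ℕ) (v : Fin n → RSpace d)
    (y : RSpace d) : Integrable (fun x => iteratedFDeriv ℝ n (F x) y v) μ := by
  have h1 : Continuous fun x => iteratedFDeriv ℝ n (F x) y v :=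
    (ContinuousMultilinearMap.apply ℝ (fun _ : Fin n => RSpace d) ℂ v).continuous.comp
      ((hc n).comp (by fun_prop : Continuous fun x : X => (x, y)))
  refine ((hg n).mul_const (∏ k, ‖v k‖)).mono' h1.aestronglyMeasurable
    (Eventually.of_forall fun x => ?_)
  refine (ContinuousMultilinearMap.le_opNorm _ _).trans ?_
  gcongr
  exact hb n x y

theorem integrable_fderiv_iteratedFDeriv_apply
    (hF : ∀ x, ContDiff ℝ ∞ (F x))
    (hc : ∀ n, Continuous fun p : X × RSpace d => iteratedFDeriv ℝ n (F p.1) p.2)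
    {g : ℕ → X → ℝ} (hg : ∀ n, Integrable (g n) μ)
    (hb : ∀ n x y, ‖iteratedFDeriv ℝ n (F x) y‖ ≤ g n x) (n : ℕ) (v : Fin n → RSpace d)
    (y : RSpace d) :
    Integrable (fun x => fderiv ℝ (fun y => iteratedFDeriv ℝ n (F x) y v) y) μ := by
  have h1 : Continuous fun x => fderiv ℝ (fun y => iteratedFDeriv ℝ n (F x) y v) y := by
    refine continuous_clm_apply.2 fun w => ?_
    simp_rw [fderiv_iteratedFDeriv_apply (hF _)]
    exact (ContinuousMultilinearMap.apply ℝ (fun _ : Fin (n + 1) => RSpace d) ℂ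
      (Fin.cons w v)).continuous.comp
      ((hc (n + 1)).comp (by fun_prop : Continuous fun x : X => (x, y)))
  refine ((hg (n + 1)).mul_const (∏ k, ‖v k‖)).mono' h1.aestronglyMeasurable
    (Eventually.of_forall fun x => ?_)
  refine (norm_fderiv_iteratedFDeriv_apply_le (hF x) n v y).trans ?_
  gcongr
  exact hb (n + 1) x y

/-- Differentiation under the integral sign, for derivatives of arbitrary order in fixed
directions. -/
theorem hasFDerivAt_integral_iteratedFDeriv_apply
    (hF : ∀ x, ContDiff ℝ ∞ (F x))
    (hc : ∀ n, Continuous fun p : X × RSpace d => iteratedFDeriv ℝ n (F p.1) p.2)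
    {g : ℕ → X → ℝ} (hg : ∀ n, Integrable (g n) μ)
    (hb : ∀ n x y, ‖iteratedFDeriv ℝ n (F x) y‖ ≤ g n x) (n : ℕ) (v : Fin n → RSpace d)
    (y : RSpace d) :
    HasFDerivAt (fun y => ∫ x, iteratedFDeriv ℝ n (F x) y v ∂μ)
      (∫ x, fderiv ℝ (fun y => iteratedFDeriv ℝ n (F x) y v) y ∂μ) y := by
  refine hasFDerivAt_integral_of_dominated_of_fderiv_le
    (bound := fun x => g (n + 1) x * ∏ k, ‖v k‖)
    (F' := fun y x => fderiv ℝ (fun y => iteratedFDeriv ℝ n (F x) y v) y) univ_mem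
    (Eventually.of_forall fun y => (integrable_iteratedFDeriv_apply hc hg hb n v y).1)
    (integrable_iteratedFDeriv_apply hc hg hb n v y)
    (integrable_fderiv_iteratedFDeriv_apply hF hc hg hb n v y).1 ?_ ((hg (n + 1)).mul_const _) ?_
  · refine Eventually.of_forall fun x y _ => ?_
    refine (norm_fderiv_iteratedFDeriv_apply_le (hF x) n v y).trans ?_
    gcongr
    exact hb (n + 1) x y
  · exact Eventually.of_forall fun x y _ => hasFDerivAt_iteratedFDeriv_apply (hF x) n v y

theorem fderiv_integral_iteratedFDeriv_apply
    (hF : ∀ x, ContDiff ℝ ∞ (F x))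
    (hc : ∀ n, Continuous fun p : X × RSpace d => iteratedFDeriv ℝ n (F p.1) p.2)
    {g : ℕ → X → ℝ} (hg : ∀ n, Integrable (g n) μ)
    (hb : ∀ n x y, ‖iteratedFDeriv ℝ n (F x) y‖ ≤ g n x) (n : ℕ) (v : Fin n → RSpace d)
    (y w : RSpace d) :
    fderiv ℝ (fun y => ∫ x, iteratedFDeriv ℝ n (F x) y v ∂μ) y w =
      ∫ x, iteratedFDeriv ℝ (n + 1) (F x) y (Fin.cons w v : Fin (n + 1) → RSpace d) ∂μ := by
  rw [(hasFDerivAt_integral_iteratedFDeriv_apply hF hc hg hb n v y).fderiv,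
    ContinuousLinearMap.integral_apply (integrable_fderiv_iteratedFDeriv_apply hF hc hg hb n v y)]
  simp_rw [fderiv_iteratedFDeriv_apply (hF _)]

theorem contDiff_integral_of_iteratedFDeriv_le
    (hF : ∀ x, ContDiff ℝ ∞ (F x))
    (hc : ∀ n, Continuous fun p : X × RSpace d => iteratedFDeriv ℝ n (F p.1) p.2)
    {g : ℕ → X → ℝ} (hg : ∀ n, Integrable (g n) μ)
    (hb : ∀ n x y, ‖iteratedFDeriv ℝ n (F x) y‖ ≤ g n x) :
    ContDiff ℝ ∞ fun y => ∫ x, F x y ∂μ := by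
  have key : ∀ (k n : ℕ) (v : Fin n → RSpace d),
      ContDiff ℝ k fun y => ∫ x, iteratedFDeriv ℝ n (F x) y v ∂μ := by
    intro k
    induction k with
    | zero =>
      intro n v
      exact contDiff_zero.2 (continuous_iff_continuousAt.2 fun y =>
        (hasFDerivAt_integral_iteratedFDeriv_apply hF hc hg hb n v y).continuousAt)
    | succ k ih =>
      intro n v
      push_cast
      refine contDiff_succ_iff_fderiv.2 ⟨fun y =>
        (hasFDerivAt_integral_iteratedFDeriv_apply hF hc hg hb n v y).differentiableAt,
        by simp, contDiff_clm_apply_iff.2 fun w => ?_⟩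
      simp_rw [fderiv_integral_iteratedFDeriv_apply hF hc hg hb n v]
      exact ih (n + 1) _
  refine contDiff_infty.2 fun k => ?_
  simpa using key k 0 Fin.elim0

theorem iteratedFDeriv_integral_apply
    (hF : ∀ x, ContDiff ℝ ∞ (F x))
    (hc : ∀ n, Continuous fun p : X × RSpace d => iteratedFDeriv ℝ n (F p.1) p.2)
    {g : ℕ → X → ℝ} (hg : ∀ n, Integrable (g n) μ)
    (hb : ∀ n x y, ‖iteratedFDeriv ℝ n (F x) y‖ ≤ g n x) (n : ℕ) (v : Fin n → RSpace d)
    (y : RSpace d) :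
    iteratedFDeriv ℝ n (fun y => ∫ x, F x y ∂μ) y v =
      ∫ x, iteratedFDeriv ℝ n (F x) y v ∂μ := by
  induction n generalizing y with
  | zero => simp
  | succ n ih =>
    have h1 := fderiv_iteratedFDeriv_apply (contDiff_integral_of_iteratedFDeriv_le hF hc hg hb)
      n (Fin.tail v) y (v 0)
    rw [Fin.cons_self_tail, funext (ih (Fin.tail v)),
      fderiv_integral_iteratedFDeriv_apply hF hc hg hb, Fin.cons_self_tail] at h1
    exact h1.symm

end ParametricIntegral

/-- The map sending `φ ∈ 𝓔^{(M_p)}` to the bounded family of all numbers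
`A ^ n / M_n * ∂^α φ (y)`, `|α| = n`, `y ∈ K`. It carries the seminorm `‖·‖_{M_p, A, K}` to the
norm of the Banach space `ℓ^∞`. -/
def jetMap {M : ℕ → ℝ} (hM : IsDefiningSequence M) {d : ℕ} {K : Set (RSpace d)}
    (hK : IsCompact K) {A : ℝ} (hA : 0 < A) :
    BeurlingE hM d →ₗ[ℂ] lp (fun _ : (Σ n : ℕ, Fin n → Fin d) × K => ℂ) ⊤ where
  toFun φ := ⟨fun p => ((A ^ p.1.1 / M p.1.1 : ℝ) : ℂ) * mixedPartial p.1.2 φ p.2, by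
    obtain ⟨C, hC⟩ := bddAbove_ultraValues.1 (φ.2.2 K hK A hA)
    refine memℓp_infty ⟨C, ?_⟩
    rintro _ ⟨⟨⟨n, i⟩, y⟩, rfl⟩
    have hn := hM.pos n
    simp only [norm_mul, Complex.norm_real]
    rw [Real.norm_of_nonneg (by positivity)]
    exact hC n i y y.2⟩
  map_add' φ ψ := by
    ext p
    simp only [Submodule.coe_add, lp.coeFn_add, Pi.add_apply]
    rw [mixedPartial_add _ φ.2.1 ψ.2.1, mul_add]
  map_smul' c φ := by
    ext p
    simp only [Submodule.coe_smul, lp.coeFn_smul, Pi.smul_apply, RingHom.id_apply, smul_eq_mul]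
    rw [mixedPartial_smul _ c φ.2.1]
    ring

section Interchange

variable {M : ℕ → ℝ} {d : ℕ} {K : Set (RSpace d)} {A : ℝ}

theorem jetMap_apply (hM : IsDefiningSequence M) (hK : IsCompact K) (hA : 0 < A)
    (φ : BeurlingE hM d) (p : (Σ n : ℕ, Fin n → Fin d) × K) :
    jetMap hM hK hA φ p = ((A ^ p.1.1 / M p.1.1 : ℝ) : ℂ) * mixedPartial p.1.2 φ p.2 := rfl

theorem norm_jetMap_apply (hM : IsDefiningSequence M) (hK : IsCompact K) (hA : 0 < A)
    (φ : BeurlingE hM d) (p : (Σ n : ℕ, Fin n → Fin d) × K) :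
    ‖jetMap hM hK hA φ p‖ = A ^ p.1.1 / M p.1.1 * ‖mixedPartial p.1.2 φ p.2‖ := by
  have hn := hM.pos p.1.1
  rw [jetMap_apply, norm_mul, Complex.norm_real, Real.norm_of_nonneg (by positivity)]

theorem ultraNorm_le_norm_jetMap (hM : IsDefiningSequence M) (hK : IsCompact K) (hA : 0 < A)
    (φ : BeurlingE hM d) : ultraNorm M A K φ ≤ ‖jetMap hM hK hA φ‖ := by
  refine Real.sSup_le ?_ (norm_nonneg _)
  rintro r ⟨n, i, y, hy, rfl⟩
  exact (norm_jetMap_apply hM hK hA φ (⟨n, i⟩, ⟨y, hy⟩)).symm.le.trans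
    (lp.norm_apply_le_norm (by simp) _ _)

theorem LinearMap.exists_rightInverse_range {k V W : Type*} [Field k] [AddCommGroup V]
    [Module k V] [AddCommGroup W] [Module k W] (J : V →ₗ[k] W) :
    ∃ s : J.range →ₗ[k] V, ∀ v, J (s v) = v := by
  obtain ⟨s, hs⟩ := J.rangeRestrict.exists_rightInverse_of_surjective J.range_rangeRestrict
  exact ⟨s, fun v => congrArg Subtype.val (LinearMap.congr_fun hs v)⟩

/-- A continuous functional on `𝓔^{(M_p)}` factors through the Banach space of jets. -/
theorem exists_strongDual_comp_jetMap (hM : IsDefiningSequence M) {f : BeurlingE hM d →ₗ[ℂ] ℂ}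
    (hf : f ∈ BeurlingEDual hM d) :
    ∃ (K : Set (RSpace d)) (hK : IsCompact K) (A : ℝ) (hA : 0 < A)
      (g : StrongDual ℂ (lp (fun _ : (Σ n : ℕ, Fin n → Fin d) × K => ℂ) ⊤)),
      ∀ φ, f φ = g (jetMap hM hK hA φ) := by
  obtain ⟨K, hK, A, hA, C, hC⟩ := hf
  set J := jetMap hM hK hA with hJ
  have hb : ∀ φ, ‖f φ‖ ≤ |C| * ‖J φ‖ := fun φ => (hC φ).trans
    (mul_le_mul (le_abs_self C) (ultraNorm_le_norm_jetMap hM hK hA φ) (ultraNorm_nonneg hM hA)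
      (abs_nonneg C))
  obtain ⟨s, hs'⟩ := J.exists_rightInverse_range
  obtain ⟨g, hg, -⟩ := exists_extension_norm_eq J.range
    ((f ∘ₗ s).mkContinuous |C| fun v => by
      have := hb (s v)
      rw [hs'] at this
      exact this)
  refine ⟨K, hK, A, hA, g, fun φ => ?_⟩
  have h1 := hg ⟨J φ, LinearMap.mem_range_self J φ⟩
  rw [h1]
  have h2 : J (φ - s ⟨J φ, LinearMap.mem_range_self J φ⟩) = 0 := by
    rw [map_sub, hs', sub_self]
  have h3 := hb (φ - s ⟨J φ, LinearMap.mem_range_self J φ⟩)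
  rw [h2, norm_zero, mul_zero, norm_le_zero_iff, map_sub, sub_eq_zero] at h3
  exact h3

variable {X : Type*} [TopologicalSpace X] {F : X → RSpace d → ℂ}

/-- Continuity into the Banach space of jets: the derivatives of high order are uniformly small
because the bounds hold with `2 A` in place of `A`, and those of low order are uniformly continuous
on compact sets. -/
theorem continuous_jetMap (hM : IsDefiningSequence M) (hK : IsCompact K) (hA : 0 < A)
    (hE : ∀ x, F x ∈ BeurlingE hM d)
    (hc : ∀ n, Continuous fun p : X × RSpace d => iteratedFDeriv ℝ n (F p.1) p.2)
    {g : X → ℝ} (hg : Continuous g) (hb : ∀ x, DerivBound M (2 * A) (g x) univ (F x)) :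
    Continuous fun x => jetMap hM hK hA ⟨F x, hE x⟩ := by
  refine continuous_iff_continuousAt.2 fun x₀ => Metric.tendsto_nhds.2 fun ε hε => ?_
  have hgx : ∀ᶠ x in 𝓝 x₀, g x < g x₀ + 1 :=
    hg.continuousAt.eventually_lt continuousAt_const (by linarith)
  obtain ⟨N, hN⟩ : ∃ N : ℕ, ∀ n ≥ N, (2 * g x₀ + 1) * (1 / 2) ^ n < ε / 2 := by
    have h0 : Tendsto (fun n : ℕ => (2 * g x₀ + 1) * (1 / 2 : ℝ) ^ n) atTop (𝓝 0) := by
      simpa using (tendsto_pow_atTop_nhds_zero_of_lt_one (r := (1 / 2 : ℝ)) (by norm_num)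
        (by norm_num)).const_mul (2 * g x₀ + 1)
    exact eventually_atTop.1 (h0.eventually_lt_const (by positivity))
  have hlow : ∀ᶠ x in 𝓝 x₀, ∀ n ∈ Finset.range N, ∀ i : Fin n → Fin d, ∀ y ∈ K,
      A ^ n / M n * ‖mixedPartial i (F x) y - mixedPartial i (F x₀) y‖ < ε / 2 := by
    refine (Finset.eventually_all _).2 fun n _ => eventually_all.2 fun i => ?_
    refine hK.eventually_forall_of_forall_eventually fun y _ => ?_
    have hmc : Continuous fun p : X × RSpace d => mixedPartial i (F p.1) p.2 :=
      (ContinuousMultilinearMap.apply ℝ (fun _ : Fin n => RSpace d) ℂ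
        fun k => EuclideanSpace.single (i k) (1 : ℝ)).continuous.comp (hc n)
    have hcont : Continuous fun p : X × RSpace d =>
        A ^ n / M n * ‖mixedPartial i (F p.1) p.2 - mixedPartial i (F x₀) p.2‖ :=
      continuous_const.mul (hmc.sub (hmc.comp
        (by fun_prop : Continuous fun p : X × RSpace d => (x₀, p.2)))).norm
    exact hcont.continuousAt.eventually_lt continuousAt_const (by simpa using half_pos hε)
  filter_upwards [hgx, hlow] with x hx hlow
  rw [dist_eq_norm]
  refine lt_of_le_of_lt (lp.norm_le_of_forall_le (half_pos hε).le ?_) (half_lt_self hε)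
  rintro ⟨⟨n, i⟩, ⟨y, hy⟩⟩
  have hn := hM.pos n
  rw [lp.coeFn_sub, Pi.sub_apply]
  by_cases hnN : n < N
  · have h1 := hlow n (Finset.mem_range.2 hnN) i y hy
    rw [jetMap_apply, jetMap_apply, ← mul_sub, norm_mul, Complex.norm_real,
      Real.norm_of_nonneg (by positivity)]
    exact h1.le
  · have hx' : ∀ z, A ^ n / M n * ‖mixedPartial i (F z) y‖ ≤ g z * (1 / 2) ^ n := fun z => by
      have h1 := (norm_mixedPartial_le i (F z) y).trans (hb z n y (mem_univ y))
      calc A ^ n / M n * ‖mixedPartial i (F z) y‖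
          ≤ A ^ n / M n * (g z * M n / (2 * A) ^ n) := by gcongr
        _ = g z * (1 / 2) ^ n := by
            rw [mul_pow, one_div, inv_pow]; field_simp
    refine (norm_sub_le _ _).trans ?_
    rw [norm_jetMap_apply, norm_jetMap_apply]
    have h2 : g x * (1 / 2 : ℝ) ^ n ≤ (g x₀ + 1) * (1 / 2) ^ n := by gcongr
    have h3 := hx' x
    have h4 := hx' x₀
    have h5 := hN n (not_lt.1 hnN)
    simp only at h3 h4 h5 ⊢
    linarith

variable [MeasurableSpace X] [OpensMeasurableSpace X] [SecondCountableTopology X] {μ : Measure X}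

/-- A continuous functional on `𝓔^{(M_p)}` may be taken under an integral that converges absolutely
in all the seminorms. -/
theorem BeurlingEDual_apply_integral (hM : IsDefiningSequence M) {f : BeurlingE hM d →ₗ[ℂ] ℂ}
    (hf : f ∈ BeurlingEDual hM d) (hE : ∀ x, F x ∈ BeurlingE hM d)
    (hc : ∀ n, Continuous fun p : X × RSpace d => iteratedFDeriv ℝ n (F p.1) p.2)
    (hb : ∀ A : ℝ, 0 < A → ∃ g : X → ℝ, Continuous g ∧ Integrable g μ ∧
      ∀ x, DerivBound M A (g x) univ (F x)) :
    ∃ hψ : (fun y => ∫ x, F x y ∂μ) ∈ BeurlingE hM d,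
      f ⟨fun y => ∫ x, F x y ∂μ, hψ⟩ = ∫ x, f ⟨F x, hE x⟩ ∂μ := by
  obtain ⟨g₁, -, hg₁, hb₁⟩ := hb 1 one_pos
  have hF : ∀ x, ContDiff ℝ ∞ (F x) := fun x => (hE x).1
  have hgn : ∀ n, Integrable (fun x => g₁ x * M n / 1 ^ n) μ := fun n =>
    (hg₁.mul_const _).div_const _
  have hbn : ∀ n x y, ‖iteratedFDeriv ℝ n (F x) y‖ ≤ g₁ x * M n / 1 ^ n := fun n x y =>
    hb₁ x n y (mem_univ y)
  have hD := iteratedFDeriv_integral_apply hF hc hgn hbn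
  have hψ : (fun y => ∫ x, F x y ∂μ) ∈ BeurlingE hM d := by
    refine mem_BeurlingE_of_derivBound hM (contDiff_integral_of_iteratedFDeriv_le hF hc hgn hbn)
      fun K _ A hA => ?_
    obtain ⟨g, -, hg, hb⟩ := hb A hA
    refine ⟨∫ x, g x ∂μ, fun n y _ => ?_⟩
    have hle : ∀ x, ‖iteratedFDeriv ℝ n (F x) y‖ ≤ g x * M n / A ^ n := fun x =>
      hb x n y (mem_univ y)
    have hint : Integrable (fun x => g x * M n / A ^ n) μ := (hg.mul_const _).div_const _
    rw [← integral_mul_const, ← integral_div]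
    refine ContinuousMultilinearMap.opNorm_le_bound
      (integral_nonneg fun x => (norm_nonneg _).trans (hle x)) fun v => ?_
    rw [hD n, ← integral_mul_const]
    refine norm_integral_le_of_norm_le (hint.mul_const _) (Eventually.of_forall fun x => ?_)
    refine (ContinuousMultilinearMap.le_opNorm _ _).trans ?_
    gcongr
    exact hle x
  refine ⟨hψ, ?_⟩
  obtain ⟨K, hK, A, hA, L, hL⟩ := exists_strongDual_comp_jetMap hM hf
  obtain ⟨g, hgc, hg, hb⟩ := hb (2 * A) (by positivity)
  have hJc := continuous_jetMap hM hK hA hE hc hgc hb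
  have hJi : Integrable (fun x => jetMap hM hK hA ⟨F x, hE x⟩) μ := by
    refine hg.norm.mono' hJc.aestronglyMeasurable (Eventually.of_forall fun x => ?_)
    refine lp.norm_le_of_forall_le (norm_nonneg _) ?_
    rintro ⟨⟨n, i⟩, ⟨y, hy⟩⟩
    have hn := hM.pos n
    rw [norm_jetMap_apply]
    have h0 : 0 ≤ g x := by
      have := (norm_nonneg _).trans (hb x 0 y (mem_univ y))
      simpa [hM.zero] using this
    have h1 : DerivBound M A (g x) univ (F x) :=
      (hb x).mono_left hM hA (by linarith) h0
    exact (h1.mem_ultraValues_le hM hA ⟨n, i, y, mem_univ y, rfl⟩).trans (le_abs_self _)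
  simp_rw [hL]
  rw [L.integral_comp_comm hJi]
  congr 1
  ext p
  have h1 := (lp.evalCLM ℂ (fun _ : (Σ n : ℕ, Fin n → Fin d) × K => ℂ) ⊤ p).integral_comp_comm hJi
  refine Eq.trans ?_ h1
  change _ = ∫ x, jetMap hM hK hA ⟨F x, hE x⟩ p ∂μ
  simp_rw [jetMap_apply]
  rw [integral_const_mul]
  congr 1
  unfold mixedPartial
  rw [hD]

end Interchange

/-! ### The Fourier transform of test functions -/

section Fourier

variable {M : ℕ → ℝ} {d : ℕ}

/-- The derivatives in the second variable of a jointly smooth function are jointly continuous. -/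
theorem continuous_iteratedFDeriv_of_contDiff_uncurry {V : Type*} [NormedAddCommGroup V]
    [NormedSpace ℝ V] {F : V → RSpace d → ℂ} (hF : ContDiff ℝ ∞ (Function.uncurry F)) (n : ℕ) :
    Continuous fun p : V × RSpace d => iteratedFDeriv ℝ n (F p.1) p.2 := by
  have h1 : ∀ p : V × RSpace d, iteratedFDeriv ℝ n (F p.1) p.2 =
      (iteratedFDeriv ℝ n (Function.uncurry F) p).compContinuousLinearMap
        fun _ => ContinuousLinearMap.inr ℝ V (RSpace d) := by
    intro p
    have h2 : F p.1 = (fun q => Function.uncurry F (q + (p.1, 0))) ∘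
        ContinuousLinearMap.inr ℝ V (RSpace d) := by
      funext y
      simp [Function.uncurry]
    have h3 : ContDiff ℝ ∞ fun q => Function.uncurry F (q + (p.1, 0)) :=
      hF.comp (contDiff_id.add contDiff_const)
    conv_lhs => rw [h2]
    rw [ContinuousLinearMap.iteratedFDeriv_comp_right _ h3 _ (by exact_mod_cast le_top),
      iteratedFDeriv_comp_add_right]
    simp
  simp_rw [h1]
  exact (ContinuousMultilinearMap.compContinuousLinearMapL
    fun _ => ContinuousLinearMap.inr ℝ V (RSpace d)).continuous.comp
      (hF.continuous_iteratedFDeriv (by exact_mod_cast le_top))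

/-- Logarithmic convexity lets a bound for the derivatives of all orders `q ≤ n` be replaced by the
bound for the order `n`. -/
theorem IsDefiningSequence.exists_div_pow_le (hM : IsDefiningSequence M) {A : ℝ} (hA : 0 < A) :
    ∃ C, 0 < C ∧ ∀ q n, q ≤ n → M q / A ^ q ≤ C * (M n / A ^ n) := by
  obtain ⟨C, hC, h⟩ := hM.exists_pow_le hA.le
  refine ⟨C, hC, fun q n hqn => ?_⟩
  obtain ⟨k, rfl⟩ := Nat.exists_eq_add_of_le hqn
  have hq := hM.pos q
  rw [mul_div_assoc', div_le_div_iff₀ (by positivity) (by positivity), pow_add]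
  calc M q * (A ^ q * A ^ k) = A ^ q * (M q * A ^ k) := by ring
    _ ≤ A ^ q * (M q * (C * M k)) := by gcongr; exact h k
    _ = C * (M q * M k) * A ^ q := by ring
    _ ≤ C * M (q + k) * A ^ q := by gcongr; exact hM.mul_le q k

/-- The easy half of the Paley-Wiener theorem for `𝓓^{(M_p)}`. -/
theorem exists_pow_mul_norm_fourier_le (hM : IsDefiningSequence M) {ψ : RSpace d → ℂ}
    (hψ : ψ ∈ BeurlingD hM d) {A : ℝ} (hA : 0 < A) :
    ∃ C, 0 ≤ C ∧ ∀ (n : ℕ) (w : RSpace d), ‖w‖ ^ n * ‖𝓕 ψ w‖ ≤ C * (M n / A ^ n) := by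
  obtain ⟨C₁, hC₁, h1⟩ := exists_derivBound_univ hM hψ (A := 4 * A) (by positivity)
  obtain ⟨C₂, hC₂, h2⟩ := hM.exists_div_pow_le (A := 4 * A) (by positivity)
  set V := volume.real (tsupport ψ) with hV
  have hcs : ∀ q, HasCompactSupport fun v => ‖iteratedFDeriv ℝ q ψ v‖ := fun q =>
    (hψ.2.iteratedFDeriv q).norm
  have hcont : ∀ q : ℕ, Continuous fun v => ‖iteratedFDeriv ℝ q ψ v‖ := fun q =>
    (hψ.1.1.continuous_iteratedFDeriv (by exact_mod_cast le_top)).norm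
  have hint : ∀ q, ∫ v, ‖iteratedFDeriv ℝ q ψ v‖ ≤ C₁ * (M q / (4 * A) ^ q) * V := by
    intro q
    have hsub : Function.support (fun v => ‖iteratedFDeriv ℝ q ψ v‖) ⊆ tsupport ψ := by
      intro v hv
      refine support_iteratedFDeriv_subset (𝕜 := ℝ) q ?_
      simpa using hv
    rw [← setIntegral_eq_integral_of_forall_compl_eq_zero fun v hv =>
      by_contra fun hne => hv (hsub hne)]
    refine (Real.le_norm_self _).trans ?_
    refine norm_setIntegral_le_of_norm_le_const hψ.2.isCompact.measure_lt_top fun v _ => ?_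
    rw [norm_norm, mul_div_assoc']
    exact h1 q v (mem_univ v)
  refine ⟨C₁ * C₂ * V, by positivity, fun n w => ?_⟩
  have hn := hM.pos n
  have h3 := Real.pow_mul_norm_iteratedFDeriv_fourier_le (f := ψ) (K := 0) (N := ⊤)
    (by exact_mod_cast hψ.1.1) (fun k n hk _ => by
      have hk0 : k = 0 := by simpa using hk
      subst hk0
      simpa using (hcont n).integrable_of_hasCompactSupport (hcs n)) (k := 0) (n := n)
    (by simp) (by simp) w
  rw [norm_iteratedFDeriv_zero] at h3
  refine h3.trans ?_
  rw [Finset.sum_product]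
  simp only [zero_add, Finset.range_one, Finset.sum_singleton, pow_zero, one_mul, Nat.cast_zero,
    mul_zero]
  calc (2 : ℝ) ^ n * ∑ q ∈ Finset.range (n + 1), ∫ v, ‖iteratedFDeriv ℝ q ψ v‖
      ≤ 2 ^ n * ∑ q ∈ Finset.range (n + 1), C₁ * (C₂ * (M n / (4 * A) ^ n)) * V := by
        gcongr with q hq
        refine (hint q).trans ?_
        gcongr
        exact h2 q n (by simpa [Nat.lt_succ_iff] using hq)
    _ = 2 ^ n * ((n + 1 : ℕ) * (C₁ * (C₂ * (M n / (4 * A) ^ n)) * V)) := by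
        rw [Finset.sum_const, Finset.card_range, nsmul_eq_mul]
    _ ≤ 2 ^ n * (2 ^ n * (C₁ * (C₂ * (M n / (4 * A) ^ n)) * V)) := by
        gcongr
        exact_mod_cast Nat.lt_two_pow_self
    _ = C₁ * C₂ * V * (M n / A ^ n) := by
        rw [mul_pow, show (4 : ℝ) = 2 * 2 by norm_num, mul_pow]
        field_simp

/-- The decay of `𝓕 ψ`, in the form that makes the inversion integral converge in every seminorm
of `𝓔^{(M_p)}`; the integrable factor is bought with (M.2). -/
theorem exists_pow_mul_norm_fourier_le_integrable (hM : IsDefiningSequence M) {ψ : RSpace d → ℂ}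
    (hψ : ψ ∈ BeurlingD hM d) {A : ℝ} (hA : 0 < A) :
    ∃ C, 0 ≤ C ∧ ∀ (n : ℕ) (w : RSpace d),
      ‖w‖ ^ n * ‖𝓕 ψ w‖ ≤ C * (1 + ‖w‖) ^ (-((d : ℝ) + 1)) * (M n / A ^ n) := by
  obtain ⟨A₀, hA₀, H, hH, h2⟩ := hM.m2
  -- The factor `H` absorbs the growth of `M_{n+d+1} / M_n`; the maximum with `1` covers order `n`.
  obtain ⟨C, hC, h1⟩ := exists_pow_mul_norm_fourier_le hM hψ (A := A * max H 1) (by positivity)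
  have hd := hM.pos (d + 1)
  refine ⟨2 ^ d * (C + C * (A₀ * M (d + 1) / A ^ (d + 1))), by positivity, fun n w => ?_⟩
  have hn := hM.pos n
  have hw : 0 < 1 + ‖w‖ := by positivity
  have hpow : (1 + ‖w‖) ^ (-((d : ℝ) + 1)) = ((1 + ‖w‖) ^ (d + 1))⁻¹ := by
    rw [Real.rpow_neg hw.le, ← Real.rpow_natCast]
    push_cast
    rfl
  have e1 : ‖w‖ ^ n * ‖𝓕 ψ w‖ ≤ C * (M n / A ^ n) := by
    refine (h1 n w).trans ?_
    gcongr
    exact le_mul_of_one_le_right hA.le (le_max_right _ _)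
  have e2 : ‖w‖ ^ (n + (d + 1)) * ‖𝓕 ψ w‖ ≤
      C * (A₀ * M (d + 1) / A ^ (d + 1)) * (M n / A ^ n) := by
    refine (h1 (n + (d + 1)) w).trans ?_
    rw [mul_assoc]
    refine mul_le_mul_of_nonneg_left ?_ hC
    calc M (n + (d + 1)) / (A * max H 1) ^ (n + (d + 1))
        ≤ A₀ * H ^ (n + (d + 1)) * M n * M (d + 1) / (A * H) ^ (n + (d + 1)) := by
          gcongr
          · exact h2 n (d + 1)
          · exact le_max_left _ _
      _ = A₀ * M (d + 1) / A ^ (d + 1) * (M n / A ^ n) := by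
          rw [mul_pow, pow_add A]
          field_simp
  have e3 : (1 + ‖w‖) ^ (d + 1) ≤ 2 ^ d * (1 + ‖w‖ ^ (d + 1)) := by
    simpa using add_pow_le zero_le_one (norm_nonneg w) (d + 1)
  rw [hpow, mul_right_comm, ← div_eq_mul_inv, le_div_iff₀ (by positivity)]
  calc ‖w‖ ^ n * ‖𝓕 ψ w‖ * (1 + ‖w‖) ^ (d + 1)
      ≤ ‖w‖ ^ n * ‖𝓕 ψ w‖ * (2 ^ d * (1 + ‖w‖ ^ (d + 1))) := by gcongr
    _ = 2 ^ d * (‖w‖ ^ n * ‖𝓕 ψ w‖ + ‖w‖ ^ (n + (d + 1)) * ‖𝓕 ψ w‖) := by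
        rw [pow_add]; ring
    _ ≤ 2 ^ d * (C * (M n / A ^ n) + C * (A₀ * M (d + 1) / A ^ (d + 1)) * (M n / A ^ n)) := by
        gcongr
    _ = _ := by ring

theorem stftExp_mem_BeurlingE (hM : IsDefiningSequence M) (ξ : RSpace d) :
    (fun y : RSpace d => Complex.exp (-Complex.I * ((inner ℝ ξ y : ℝ) : ℂ))) ∈ BeurlingE hM d :=
  mem_BeurlingE_of_derivBound hM (contDiff_stftExp ξ) fun K _ _ hA =>
    ⟨_, derivBound_stftExp hM ξ hA K⟩

/-- Injectivity of the Fourier transform on `(𝓔^{(M_p)})'`: a functional that vanishes on all the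
exponentials vanishes on `𝓓^{(M_p)}`, by Fourier inversion. -/
theorem BeurlingEDual_eq_zero_of_exp (hM : IsDefiningSequence M) {f : BeurlingE hM d →ₗ[ℂ] ℂ}
    (hf : f ∈ BeurlingEDual hM d) (h0 : ∀ ξ, f ⟨_, stftExp_mem_BeurlingE hM ξ⟩ = 0)
    (ψ : BeurlingD hM d) : f ⟨ψ, BeurlingD_le_BeurlingE hM d ψ.2⟩ = 0 := by
  obtain ⟨ψ, hψ⟩ := ψ
  have hψc : Continuous ψ := hψ.1.1.continuous
  have hψi : Integrable ψ := hψc.integrable_of_hasCompactSupport hψ.2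
  have hFc : Continuous (𝓕 ψ) := VectorFourier.fourierIntegral_continuous
    Real.continuous_fourierChar (by exact continuous_inner) hψi
  have hdim : ((Module.finrank ℝ (RSpace d) : ℕ) : ℝ) < (d : ℝ) + 1 := by simp
  have hgi : ∀ C : ℝ, Integrable fun w : RSpace d => C * (1 + ‖w‖) ^ (-((d : ℝ) + 1)) :=
    fun C => (integrable_one_add_norm hdim).const_mul C
  have hFi : Integrable (𝓕 ψ) := by
    obtain ⟨C, -, hC⟩ := exists_pow_mul_norm_fourier_le_integrable hM hψ one_pos
    exact (hgi C).mono' hFc.aestronglyMeasurable (Eventually.of_forall fun w => by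
      simpa [hM.zero] using hC 0 w)
  have hinv := hψc.fourierInv_fourier_eq hψi hFi
  -- `𝓕` uses the kernel `e^{-2πi⟨v, w⟩}`, whence the frequency `-2πw` in the inversion integral.
  set F : RSpace d → RSpace d → ℂ := fun w =>
    𝓕 ψ w • fun y => Complex.exp (-Complex.I * ((inner ℝ (-(2 * Real.pi) • w) y : ℝ) : ℂ)) with hF
  have hψF : ψ = fun y => ∫ w, F w y := by
    conv_lhs => rw [← hinv]
    funext y
    rw [Real.fourierInv_eq']
    refine integral_congr_ae (Eventually.of_forall fun w => ?_)
    simp only [hF, Pi.smul_apply, smul_eq_mul, inner_smul_left]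
    rw [mul_comm]
    congr 2
    simp only [conj_trivial]
    push_cast
    ring
  have hE : ∀ w, F w ∈ BeurlingE hM d := fun w =>
    (BeurlingE hM d).smul_mem _ (stftExp_mem_BeurlingE hM _)
  have hDF : ∀ (n : ℕ) (w y : RSpace d), iteratedFDeriv ℝ n (F w) y = 𝓕 ψ w • iteratedFDeriv ℝ n
      (fun y => Complex.exp (-Complex.I * ((inner ℝ (-(2 * Real.pi) • w) y : ℝ) : ℂ))) y :=
    fun n w y => iteratedFDeriv_const_smul_apply
      (((contDiff_stftExp _).of_le (by exact_mod_cast le_top)).contDiffAt)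
  have hcont : ∀ n : ℕ, Continuous fun p : RSpace d × RSpace d =>
      iteratedFDeriv ℝ n (F p.1) p.2 := by
    intro n
    simp_rw [hDF]
    refine (hFc.comp continuous_fst).smul (continuous_iteratedFDeriv_of_contDiff_uncurry
      (F := fun (w y : RSpace d) =>
        Complex.exp (-Complex.I * ((inner ℝ (-(2 * Real.pi) • w) y : ℝ) : ℂ))) ?_ n)
    have hs : ContDiff ℝ ∞ fun p : RSpace d × RSpace d => -(2 * Real.pi) • p.1 :=
      contDiff_fst.const_smul _
    have hi : ContDiff ℝ ∞ fun p : RSpace d × RSpace d => inner ℝ (-(2 * Real.pi) • p.1) p.2 :=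
      hs.inner ℝ contDiff_snd
    have h1 : ContDiff ℝ ∞ fun p : RSpace d × RSpace d =>
        ((inner ℝ (-(2 * Real.pi) • p.1) p.2 : ℝ) : ℂ) := Complex.ofRealCLM.contDiff.comp hi
    exact (contDiff_const.mul h1).cexp
  obtain ⟨hmem, hval⟩ := BeurlingEDual_apply_integral (μ := volume) hM hf hE hcont fun A hA => by
    obtain ⟨C, hC, h1⟩ := exists_pow_mul_norm_fourier_le_integrable hM hψ
      (A := 2 * Real.pi * A) (by positivity)
    refine ⟨fun w => C * (1 + ‖w‖) ^ (-((d : ℝ) + 1)), ?_, hgi C, fun w n y _ => ?_⟩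
    · exact continuous_const.mul ((continuous_const.add continuous_norm).rpow_const
        fun w => Or.inl (add_pos_of_pos_of_nonneg one_pos (norm_nonneg w)).ne')
    · rw [hDF, norm_smul]
      have h2 := norm_iteratedFDeriv_stftExp_le (-(2 * Real.pi) • w) n y
      rw [norm_smul, norm_neg, Real.norm_of_nonneg (by positivity), mul_pow] at h2
      calc _ ≤ ‖𝓕 ψ w‖ * ((2 * Real.pi) ^ n * ‖w‖ ^ n) := by gcongr
        _ = (2 * Real.pi) ^ n * (‖w‖ ^ n * ‖𝓕 ψ w‖) := by ring
        _ ≤ (2 * Real.pi) ^ n * (C * (1 + ‖w‖) ^ (-((d : ℝ) + 1)) *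
              (M n / (2 * Real.pi * A) ^ n)) :=
            mul_le_mul_of_nonneg_left (h1 n w) (by positivity)
        _ = _ := by
            rw [mul_pow (2 * Real.pi) A]
            field_simp
  have hzero : ∀ w, f ⟨F w, hE w⟩ = 0 := fun w => by
    have := f.map_smul (𝓕 ψ w) ⟨_, stftExp_mem_BeurlingE hM (-(2 * Real.pi) • w)⟩
    rw [h0, smul_zero] at this
    exact this
  simp_rw [hzero, integral_zero] at hval
  rw [← hval]
  congr 1
  exact Subtype.ext hψF

end Fourier

/-! ### Multiplication by test functions and the resolution of unity by a window -/

section Window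

variable {M : ℕ → ℝ} {d : ℕ}

/-- Multiplication by `θ ∈ 𝓓^{(M_p)}`, as a map from `𝓔^{(M_p)}` to `𝓓^{(M_p)}`. -/
def mulTest (hM : IsDefiningSequence M) (θ : BeurlingD hM d) :
    BeurlingE hM d →ₗ[ℂ] BeurlingD hM d where
  toFun ψ := ⟨fun y => (θ : RSpace d → ℂ) y * (ψ : RSpace d → ℂ) y,
    mul_mem_BeurlingE hM θ.2.1 ψ.2, θ.2.2.mul_right⟩
  map_add' _ _ := Subtype.ext (funext fun _ => mul_add _ _ _)
  map_smul' _ _ := Subtype.ext (funext fun _ => mul_left_comm _ _ _)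

theorem comp_mulTest_mem_BeurlingEDual (hM : IsDefiningSequence M) {f : BeurlingD hM d →ₗ[ℂ] ℂ}
    (hf : f ∈ BeurlingDDual hM d) (θ : BeurlingD hM d) :
    f ∘ₗ mulTest hM θ ∈ BeurlingEDual hM d := by
  have hK : IsCompact (tsupport (θ : RSpace d → ℂ)) := θ.2.2
  obtain ⟨A, hA, C, hC⟩ := hf _ hK
  refine ⟨_, hK, (d + 1) * (2 * A), by positivity,
    |C| * ultraNorm M ((d + 1) * (2 * A)) (tsupport (θ : RSpace d → ℂ)) θ, fun ψ => ?_⟩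
  have h1 := hC (mulTest hM θ ψ) (tsupport_mul_subset_left)
  refine h1.trans ?_
  have h2 := ultraNorm_mul_le hM θ.2.1 ψ.2 hK hA
  rw [mul_assoc]
  exact mul_le_mul (le_abs_self C) h2 (ultraNorm_nonneg hM hA) (abs_nonneg C)

theorem translate_mem_BeurlingD (hM : IsDefiningSequence M) {φ : RSpace d → ℂ}
    (hφ : φ ∈ BeurlingD hM d) (x : RSpace d) : (fun y => φ (y - x)) ∈ BeurlingD hM d := by
  refine ⟨mem_BeurlingE_of_derivBound hM (hφ.1.1.comp (contDiff_id.sub contDiff_const))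
    fun K _ A hA => ?_, hφ.2.comp_homeomorph (Homeomorph.subRight x)⟩
  obtain ⟨C, -, hC⟩ := exists_derivBound_univ hM hφ hA
  refine ⟨C, fun n y _ => ?_⟩
  rw [iteratedFDeriv_comp_sub]
  exact hC n (y - x) (mem_univ _)

/-- The function `|φ|²`, as a complex-valued function. -/
def windowSq (φ : RSpace d → ℂ) : RSpace d → ℂ := fun y => (starRingEnd ℂ) (φ y) * φ y

theorem windowSq_mem_BeurlingD (hM : IsDefiningSequence M) {φ : RSpace d → ℂ}
    (hφ : φ ∈ BeurlingD hM d) : windowSq φ ∈ BeurlingD hM d := by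
  have h1 := stftAtom_mem_BeurlingD hM hφ 0 0
  have h2 : stftAtom φ 0 0 = fun y => (starRingEnd ℂ) (φ y) := by
    funext y
    simp [stftAtom]
  rw [h2] at h1
  exact ⟨mul_mem_BeurlingE hM h1.1 hφ.1, h1.2.mul_right⟩

theorem integral_windowSq_ne_zero (hM : IsDefiningSequence M) {φ : RSpace d → ℂ}
    (hφ : φ ∈ BeurlingD hM d) (h0 : φ ≠ 0) : ∫ y, windowSq φ y ≠ 0 := by
  obtain ⟨y₀, hy₀⟩ := Function.ne_iff.1 h0
  have h1 : ∀ y, windowSq φ y = ((‖φ y‖ ^ 2 : ℝ) : ℂ) := fun y => by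
    rw [windowSq, Complex.conj_mul']
    push_cast
    rfl
  simp_rw [h1]
  rw [integral_complex_ofReal]
  refine Complex.ofReal_ne_zero.2 (ne_of_gt ?_)
  refine Continuous.integral_pos_of_hasCompactSupport_nonneg_nonzero (x := y₀)
    (hφ.1.1.continuous.norm.pow 2) ?_ (fun y => by positivity) (by simpa using hy₀)
  exact hφ.2.comp_left (g := fun z : ℂ => ‖z‖ ^ 2) (by simp)

/-- The convolution of `|φ|²` with the indicator function of a set `S` of points: the integral over
`x ∈ S` of the translates `|φ(· - x)|²`. For a large ball `S` it is a cutoff function, up to the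
factor `∫ |φ|²`. -/
def windowCutoff (φ : RSpace d → ℂ) (S : Set (RSpace d)) : RSpace d → ℂ :=
  fun y => ∫ x in S, windowSq φ (y - x)

theorem BeurlingEDual_apply_windowCutoff (hM : IsDefiningSequence M) {φ : RSpace d → ℂ}
    (hφ : φ ∈ BeurlingD hM d) {S : Set (RSpace d)} (hS : volume S < ⊤)
    {f : BeurlingE hM d →ₗ[ℂ] ℂ} (hf : f ∈ BeurlingEDual hM d) :
    ∃ h : windowCutoff φ S ∈ BeurlingE hM d, f ⟨windowCutoff φ S, h⟩ =
      ∫ x in S, f ⟨fun y => windowSq φ (y - x),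
        (translate_mem_BeurlingD hM (windowSq_mem_BeurlingD hM hφ) x).1⟩ := by
  have hΦ := windowSq_mem_BeurlingD hM hφ
  have : IsFiniteMeasure (volume.restrict S) := ⟨by simpa using hS⟩
  refine BeurlingEDual_apply_integral (F := fun x y => windowSq φ (y - x)) hM hf
    (fun x => (translate_mem_BeurlingD hM hΦ x).1) (fun n => ?_) fun A hA => ?_
  · simp_rw [iteratedFDeriv_comp_sub]
    exact (hΦ.1.1.continuous_iteratedFDeriv (by exact_mod_cast le_top)).comp
      (continuous_snd.sub continuous_fst)
  · obtain ⟨C, -, hC⟩ := exists_derivBound_univ hM hΦ hA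
    refine ⟨fun _ => C, continuous_const, integrable_const C, fun x n y _ => ?_⟩
    rw [iteratedFDeriv_comp_sub]
    exact hC n (y - x) (mem_univ _)

theorem windowSq_eq_zero {φ : RSpace d → ℂ} {r : ℝ} (hr : ∀ y ∈ tsupport φ, ‖y‖ ≤ r)
    {y : RSpace d} (hy : r < ‖y‖) : windowSq φ y = 0 := by
  have : φ y = 0 := image_eq_zero_of_notMem_tsupport fun h => absurd (hr y h) (not_le.2 hy)
  rw [windowSq, this, mul_zero]

theorem windowCutoff_mem_BeurlingD (hM : IsDefiningSequence M) {φ : RSpace d → ℂ}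
    (hφ : φ ∈ BeurlingD hM d) (R : ℝ) :
    windowCutoff φ (Metric.closedBall 0 R) ∈ BeurlingD hM d := by
  obtain ⟨r, -, hr⟩ := hφ.2.isCompact.isBounded.exists_pos_norm_le
  -- Membership in `𝓔^{(M_p)}` is read off from the interchange lemma for the zero functional.
  have hzero : (0 : BeurlingE hM d →ₗ[ℂ] ℂ) ∈ BeurlingEDual hM d :=
    ⟨∅, isCompact_empty, 1, one_pos, 0, fun ψ => by simp⟩
  refine ⟨(BeurlingEDual_apply_windowCutoff hM hφ measure_closedBall_lt_top hzero).1,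
    HasCompactSupport.intro (isCompact_closedBall (0 : RSpace d) (R + r)) fun y hy => ?_⟩
  rw [mem_closedBall_zero_iff, not_le] at hy
  refine setIntegral_eq_zero_of_forall_eq_zero fun x hx => windowSq_eq_zero hr ?_
  rw [mem_closedBall_zero_iff] at hx
  linarith [norm_sub_norm_le y x]

theorem windowCutoff_eq_integral {φ : RSpace d → ℂ} {r R : ℝ} (hr : ∀ y ∈ tsupport φ, ‖y‖ ≤ r)
    {y : RSpace d} (hy : ‖y‖ + r ≤ R) :
    windowCutoff φ (Metric.closedBall 0 R) y = ∫ z, windowSq φ z := by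
  rw [windowCutoff, setIntegral_eq_integral_of_forall_compl_eq_zero fun x hx =>
    windowSq_eq_zero hr ?_]
  · exact integral_sub_left_eq_self (windowSq φ) volume y
  · rw [mem_closedBall_zero_iff, not_le] at hx
    have := norm_sub_norm_le x y
    rw [norm_sub_rev] at this
    linarith

end Window

/-! ### Compactly supported ultradistributions -/

section Support

variable {M : ℕ → ℝ} {d : ℕ} {hM : IsDefiningSequence M} {f : BeurlingD hM d →ₗ[ℂ] ℂ}
  {φ : BeurlingD hM d}

theorem stftD_eq_zero_iff {x ξ : RSpace d} : stftD hM f φ x ξ = 0 ↔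
    f ⟨stftAtom φ x ξ, stftAtom_mem_BeurlingD hM φ.2 x ξ⟩ = 0 := by
  have hp : (((2 * Real.pi) ^ (-(d : ℝ) / 2) : ℝ) : ℂ) ≠ 0 :=
    Complex.ofReal_ne_zero.2 (Real.rpow_pos_of_pos (by positivity) _).ne'
  rw [stftD, mul_eq_zero, or_iff_right hp]

/-- If `V_φ f (x, ·) = 0`, then the ultradistribution `conj φ(· - x) f` of compact support has
vanishing Fourier transform, so it is zero. -/
theorem apply_conj_translate_mul_eq_zero (hf : f ∈ BeurlingDDual hM d) {x : RSpace d}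
    (hx : ∀ ξ, stftD hM f φ x ξ = 0) (ψ : BeurlingD hM d) :
    f (mulTest hM ⟨stftAtom φ x 0, stftAtom_mem_BeurlingD hM φ.2 x 0⟩
      ⟨ψ, BeurlingD_le_BeurlingE hM d ψ.2⟩) = 0 := by
  refine BeurlingEDual_eq_zero_of_exp hM (comp_mulTest_mem_BeurlingEDual hM hf
    ⟨stftAtom φ x 0, stftAtom_mem_BeurlingD hM φ.2 x 0⟩) (fun ξ => ?_) ψ
  rw [← stftD_eq_zero_iff.1 (hx ξ), LinearMap.comp_apply]
  congr 1
  refine Subtype.ext (funext fun y => ?_)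
  simp [mulTest, stftAtom]

theorem apply_mul_windowSq_eq_zero (hf : f ∈ BeurlingDDual hM d) {x : RSpace d}
    (hx : ∀ ξ, stftD hM f φ x ξ = 0) (ψ : BeurlingD hM d) :
    (f ∘ₗ mulTest hM ψ) ⟨fun y => windowSq (φ : RSpace d → ℂ) (y - x),
      (translate_mem_BeurlingD hM (windowSq_mem_BeurlingD hM φ.2) x).1⟩ = 0 := by
  have h1 := translate_mem_BeurlingD hM φ.2 x
  rw [← apply_conj_translate_mul_eq_zero hf hx (mulTest hM ⟨_, h1⟩
    ⟨ψ, BeurlingD_le_BeurlingE hM d ψ.2⟩), LinearMap.comp_apply]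
  congr 1
  refine Subtype.ext (funext fun y => ?_)
  simp only [mulTest, LinearMap.coe_mk, AddHom.coe_mk, windowSq, stftAtom]
  simp
  ring

/-- If `V_φ f (x, ·) = 0` for `x` outside a ball, then the integral over a larger ball of the
translates `|φ(· - x)|² f` does not depend on the larger ball; dividing by `∫ |φ|²`, one finds that
`f` is the product of `f` and a cutoff function. -/
theorem belongsToEDual_of_stftD_eq_zero (hf : f ∈ BeurlingDDual hM d) (hφ : φ ≠ 0) {R₀ : ℝ}
    (h0 : ∀ x : RSpace d, R₀ < ‖x‖ → ∀ ξ, stftD hM f φ x ξ = 0) : BelongsToEDual hM f := by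
  set c : ℂ := ∫ z, windowSq (φ : RSpace d → ℂ) z with hc
  have hc0 : c ≠ 0 := integral_windowSq_ne_zero hM φ.2 fun h => hφ (Subtype.ext h)
  obtain ⟨r, -, hr⟩ := φ.2.2.isCompact.isBounded.exists_pos_norm_le
  have hχ := windowCutoff_mem_BeurlingD hM φ.2 R₀
  have hg := comp_mulTest_mem_BeurlingEDual hM hf
    (c⁻¹ • (⟨windowCutoff (φ : RSpace d → ℂ) (Metric.closedBall 0 R₀), hχ⟩ : BeurlingD hM d))
  refine ⟨_, hg, fun ψ => ?_⟩
  obtain ⟨R₁, -, hR₁⟩ := ψ.2.2.isCompact.isBounded.exists_pos_norm_le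
  set R := max R₀ (R₁ + r)
  have hu := comp_mulTest_mem_BeurlingEDual hM hf ψ
  obtain ⟨hE₀, h₀⟩ := BeurlingEDual_apply_windowCutoff hM φ.2
    (S := Metric.closedBall 0 R₀) measure_closedBall_lt_top hu
  obtain ⟨hE, h⟩ := BeurlingEDual_apply_windowCutoff hM φ.2
    (S := Metric.closedBall 0 R) measure_closedBall_lt_top hu
  have hsame := setIntegral_eq_of_subset_of_forall_sdiff_eq_zero (μ := volume)
    (s := Metric.closedBall (0 : RSpace d) R₀) (t := Metric.closedBall (0 : RSpace d) R)
    (f := fun x => (f ∘ₗ mulTest hM ψ) ⟨fun y => windowSq (φ : RSpace d → ℂ) (y - x),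
      (translate_mem_BeurlingD hM (windowSq_mem_BeurlingD hM φ.2) x).1⟩)
    measurableSet_closedBall (Metric.closedBall_subset_closedBall (le_max_left _ _))
    fun x hx => apply_mul_windowSq_eq_zero hf (h0 x (by simpa using hx.2)) ψ
  rw [← h, ← h₀] at hsame
  have e1 : (f ∘ₗ mulTest hM ψ) ⟨_, hE⟩ = c * f ψ := by
    rw [LinearMap.comp_apply, ← smul_eq_mul, ← map_smul]
    congr 1
    refine Subtype.ext (funext fun y => ?_)
    change (ψ : RSpace d → ℂ) y * windowCutoff (φ : RSpace d → ℂ) (Metric.closedBall 0 R) y =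
      c * (ψ : RSpace d → ℂ) y
    by_cases hy : y ∈ tsupport (ψ : RSpace d → ℂ)
    · rw [windowCutoff_eq_integral hr ((add_le_add_left (hR₁ y hy) r).trans (le_max_right _ _)),
        mul_comm]
    · rw [image_eq_zero_of_notMem_tsupport hy, zero_mul, mul_zero]
  have e2 : (f ∘ₗ mulTest hM ψ) ⟨_, hE₀⟩ = c * (f ∘ₗ mulTest hM
      (c⁻¹ • (⟨windowCutoff (φ : RSpace d → ℂ) (Metric.closedBall 0 R₀), hχ⟩ : BeurlingD hM d)))
      ⟨ψ, BeurlingD_le_BeurlingE hM d ψ.2⟩ := by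
    rw [LinearMap.comp_apply, LinearMap.comp_apply, ← smul_eq_mul, ← map_smul]
    congr 1
    refine Subtype.ext (funext fun y => ?_)
    change (ψ : RSpace d → ℂ) y * windowCutoff (φ : RSpace d → ℂ) (Metric.closedBall 0 R₀) y =
      c * (c⁻¹ * windowCutoff (φ : RSpace d → ℂ) (Metric.closedBall 0 R₀) y * (ψ : RSpace d → ℂ) y)
    field_simp
  rw [e1, e2] at hsame
  exact mul_left_cancel₀ hc0 hsame

/-- A continuous functional on `𝓔^{(M_p)}` is controlled on a compact set `K`; the atoms centred
outside `K - supp φ` vanish near `K`. -/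
theorem exists_tsupport_stftD_subset (hf : BelongsToEDual hM f) (φ : BeurlingD hM d) :
    ∃ K : Set (RSpace d), IsCompact K ∧
      tsupport (fun z : RSpace d × RSpace d => stftD hM f φ z.1 z.2) ⊆ K ×ˢ Set.univ := by
  obtain ⟨g, ⟨K, hK, A, hA, C, hg⟩, hfg⟩ := hf
  set T := tsupport (φ : RSpace d → ℂ) with hT
  have hK' : IsCompact ((fun p : RSpace d × RSpace d => p.1 - p.2) '' (K ×ˢ T)) :=
    (hK.prod φ.2.2).image (continuous_fst.sub continuous_snd)
  refine ⟨_, hK', closure_minimal (fun z hz => ⟨?_, mem_univ _⟩) (hK'.isClosed.prod isClosed_univ)⟩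
  by_contra hx
  refine hz (stftD_eq_zero_iff.2 ?_)
  have hsub : tsupport (stftAtom (φ : RSpace d → ℂ) z.1 z.2) ⊆ {y | y - z.1 ∈ T} := by
    refine closure_minimal (fun y hy => ?_)
      ((isClosed_tsupport _).preimage (continuous_id.sub continuous_const))
    refine subset_tsupport _ fun h => hy ?_
    simp only [stftAtom, h, map_zero, zero_mul]
  have hD : DerivBound M A 0 K (stftAtom (φ : RSpace d → ℂ) z.1 z.2) := by
    intro n y hy
    have h1 : iteratedFDeriv ℝ n (stftAtom (φ : RSpace d → ℂ) z.1 z.2) y = 0 :=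
      image_eq_zero_of_notMem_tsupport fun h =>
        hx ⟨(y, y - z.1), ⟨hy, hsub (tsupport_iteratedFDeriv_subset n h)⟩, sub_sub_cancel _ _⟩
    simp [h1]
  have h0 : ultraNorm M A K (stftAtom (φ : RSpace d → ℂ) z.1 z.2) = 0 :=
    le_antisymm (hD.ultraNorm_le hM hA le_rfl) (ultraNorm_nonneg hM hA)
  rw [hfg]
  refine norm_le_zero_iff.1 ((hg _).trans (le_of_eq ?_))
  change C * ultraNorm M A K (stftAtom (φ : RSpace d → ℂ) z.1 z.2) = 0
  rw [h0, mul_zero]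

end Support

end

/-! ### Growth and support of the short-time Fourier transform -/

theorem mainTheorem5 {d : ℕ} {M : ℕ → ℝ} (hM : IsDefiningSequence M) :
    (∀ f ∈ BeurlingEDual hM d, ∀ (φ : RSpace d → ℂ) (hφ : φ ∈ BeurlingS M d),
      (∃ ε : ℝ, 0 < ε ∧ ∀ h : ℝ, 0 < h → ∃ C : ℝ, 0 < C ∧ ∀ x ξ : RSpace d,
        ‖stftE hM f ⟨φ, BeurlingS_subset_BeurlingE hM hφ⟩ x ξ‖ ≤
          C * (Real.exp (-h * assocFun M ‖x‖) * Real.exp (assocFun M (ε * ‖ξ‖)))) ∧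
      (AssocDoubling M →
        ∃ ε : ℝ, 0 < ε ∧ ∀ h : ℝ, 0 < h → ∃ C : ℝ, 0 < C ∧ ∀ x ξ : RSpace d,
          ‖stftE hM f ⟨φ, BeurlingS_subset_BeurlingE hM hφ⟩ x ξ‖ ≤
            C * (Real.exp (-h * assocFun M ‖x‖) * Real.exp (ε * assocFun M ‖ξ‖)))) ∧
    (∀ f ∈ BeurlingDDual hM d, ∀ φ : BeurlingD hM d, φ ≠ 0 →
      (BelongsToEDual hM f ↔
        ∃ K : Set (RSpace d), IsCompact K ∧
          tsupport (fun z : RSpace d × RSpace d => stftD hM f φ z.1 z.2) ⊆ K ×ˢ Set.univ) ∧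
      (BelongsToEDual hM f →
        (∃ ε : ℝ, 0 < ε ∧ ∃ C : ℝ, 0 < C ∧ ∀ x ξ : RSpace d,
          ‖stftD hM f φ x ξ‖ ≤ C * Real.exp (assocFun M (ε * ‖ξ‖))) ∧
        (AssocDoubling M →
          ∃ ε : ℝ, 0 < ε ∧ ∃ C : ℝ, 0 < C ∧ ∀ x ξ : RSpace d,
            ‖stftD hM f φ x ξ‖ ≤ C * Real.exp (ε * assocFun M ‖ξ‖)))) := by
  refine ⟨fun f hf φ hφ => ⟨stftE_growth hM hf hφ, stftE_growth_of_doubling hM hf hφ⟩,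
    fun f hf φ hφ => ⟨⟨fun h => exists_tsupport_stftD_subset h φ, ?_⟩, ?_⟩⟩
  · rintro ⟨K, hK, hsub⟩
    obtain ⟨R₀, -, hR₀⟩ := hK.isBounded.exists_pos_norm_le
    refine belongsToEDual_of_stftD_eq_zero hf hφ (R₀ := R₀) fun x hx ξ => ?_
    by_contra hne
    have h1 : (x, ξ) ∈ K ×ˢ (univ : Set (RSpace d)) := hsub (subset_tsupport _ hne)
    exact absurd (hR₀ x h1.1) (not_le.2 hx)
  · rintro ⟨g, hg, hfg⟩
    have hφS := BeurlingD_subset_BeurlingS hM φ.2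
    have hV : ∀ x ξ, stftD hM f φ x ξ = stftE hM g ⟨φ, BeurlingS_subset_BeurlingE hM hφS⟩ x ξ :=
      fun x ξ => congrArg _ (hfg _)
    have hle : ∀ x : RSpace d, Real.exp (-1 * assocFun M ‖x‖) ≤ 1 := fun x =>
      Real.exp_le_one_iff.2 (by linarith [assocFun_nonneg M ‖x‖])
    constructor
    · obtain ⟨ε, hε, h⟩ := stftE_growth hM hg hφS
      obtain ⟨C, hC, h⟩ := h 1 one_pos
      refine ⟨ε, hε, C, hC, fun x ξ => ?_⟩
      rw [hV]
      refine (h x ξ).trans (mul_le_mul_of_nonneg_left ?_ hC.le)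
      exact mul_le_of_le_one_left (Real.exp_pos _).le (hle x)
    · intro hd
      obtain ⟨ε, hε, h⟩ := stftE_growth_of_doubling hM hg hφS hd
      obtain ⟨C, hC, h⟩ := h 1 one_pos
      refine ⟨ε, hε, C, hC, fun x ξ => ?_⟩
      rw [hV]
      refine (h x ξ).trans (mul_le_mul_of_nonneg_left ?_ hC.le)
      exact mul_le_of_le_one_left (Real.exp_pos _).le (hle x)
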